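/- **Replace expansion.** Consider the Cramér–Lundberg risk model with premium rate $1$, initial capital $u\ge 0$, claims arriving according to a Poisson process $(N_\epsilon(t))_{t\ge0}$ of rate $\lambda>0$, and i.i.d. claim sizes $U_{\epsilon,1},U_{\epsilon,2},\dots$, independent of the arrivals, with common law $G_\epsilon=(1-\epsilon)\,\mathrm{law}(B)+\epsilon\,\mathrm{law}(C)$, where $\epsilon\in[0,1]$, $B\ge0$ is phase-type with $0<\mathbb E B<\infty$ and $C\ge0$ is heavy-tailed ($\mathbb E e^{sC}=\infty$ for all $s>0$) with $\mathbb E C<\infty$. Put $\delta=\lambda\mathbb E B$, $\theta=\lambda\mathbb E C$ and assume the stability condition $\rho_\epsilon=(1-\epsilon)\delta+\epsilon\theta<1$. Let $M_\epsilon=\sup_{t\ge0}\big(\sum_{i=1}^{N_\epsilon(t)}U_{\epsilon,i}-t\big)$, let $\psi_\epsilon(u)=\mathbb P(M_\epsilon>u)$ be the ruin probability, and let $M_0$ and $\psi_0(u)=\mathbb P(M_0>u)$ be the corresponding quantities for the replace model $\epsilon=0$, in which all claims have the law of $B$. For a random variable $X\ge0$ of positive finite mean let $X^e$ have the stationary excess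 law $\mathbb P(X^e\le x)=\frac1{\mathbb E X}\int_0^x\mathbb P(X>t)\,dt$, and let $$L_{s,m,r}(u)=\mathbb P\big(M_{0,0}+\dots+M_{0,s}+C^e_1+\dots+C^e_m+B^e_1+\dots+B^e_r>u\big),$$ where all summands are independent, the $M_{0,i}$ are copies of $M_0$, the $C^e_j$ of $C^e$ and the $B^e_l$ of $B^e$. Consider, for $u\ge0$, the two series $$\Sigma_1(u)=\sum_{n=1}^\infty\Big(\frac{\epsilon}{1-\delta}\Big)^n\sum_{k=0}^{n-1}\binom{n-1}{k}\theta^k(-\delta)^{n-1-k}\big(L_{n,k+1,n-1-k}(u)-L_{n-1,k,n-1-k}(u)\big),$$ $$\Sigma_2(u)=\sum_{n=1}^\infty\Big(\frac{\epsilon}{1-\delta}\Big)^n\sum_{k=0}^{n-1}\binom{n-1}{k}\theta^k(-\delta)^{n-1-k}\big(L_{n,k,n-k}(u)-L_{n-1,k,n-1-k}(u)\big).$$ (i) If $\delta<1$ (so that the replace model is stable), then $L_{0,0,0}(u)=\psi_0(u)$ for every $u\ge0$, and for every $u\ge0$ at which both series converge, $$\psi_\epsilon(u)=\psi_0(u)+\theta\,\Sigma_1(u)-\delta\,\Sigma_2(u).$$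 (ii) If $\epsilon<|1-\delta|/\max\{\delta,\theta\}$, then for every $u\ge0$ both series converge (absolutely) and the identity in (i) holds. -/

import Mathlib

open MeasureTheory ProbabilityTheory Filter Topology Set
open scoped NNReal ENNReal Matrix

noncomputable section

namespace RuinReplace

/-- Phase-type law: the law on `[0, ∞)` of the absorption time of a finite Markov jump process
with initial (sub)probability vector `α` on the transient states (the missing mass starts in the
absorbing state) and sub-intensity matrix `T`, that is `μ (x, ∞) = α exp(x T) 1` for `x ≥ 0`.
Invertibility of `T` says that all the non-absorbing states are transient. -/
def IsPhaseType (μ : Measure ℝ) : Prop :=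
  IsProbabilityMeasure μ ∧ μ (Iio 0) = 0 ∧
    ∃ (d : ℕ) (α : Fin d → ℝ) (T : Matrix (Fin d) (Fin d) ℝ),
      (∀ i, 0 ≤ α i) ∧ ∑ i, α i ≤ 1 ∧
      (∀ i j, i ≠ j → 0 ≤ T i j) ∧ (∀ i, ∑ j, T i j ≤ 0) ∧ IsUnit T ∧
      ∀ x : ℝ, 0 ≤ x → μ.real (Ioi x) = α ⬝ᵥ (NormedSpace.exp (x • T) *ᵥ fun _ => 1)

/-- Heavy-tailed law on `[0, ∞)`: all exponential moments of positive order are infinite. -/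
def IsHeavyTailed (μ : Measure ℝ) : Prop :=
  IsProbabilityMeasure μ ∧ μ (Iio 0) = 0 ∧
    ∀ s : ℝ, 0 < s → ∫⁻ x, ENNReal.ofReal (Real.exp (s * x)) ∂μ = ⊤

/-- The claim size law `(1 - ε) μB + ε μC`. -/
def claimLaw (ε : ℝ) (μB μC : Measure ℝ) : Measure ℝ :=
  ENNReal.ofReal (1 - ε) • μB + ENNReal.ofReal ε • μC

/-- Average amount of claim per unit time: the arrival rate times the mean of the law. -/
def load (lam : ℝ) (F : Measure ℝ) : ℝ := lam * ∫ x, x ∂F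

/-- Stationary excess law of `F`: distribution function `(1 / m) ∫₀ᵘ F (t, ∞) dt`, where `m` is
the mean of `F`. -/
def excess (F : Measure ℝ) : Measure ℝ :=
  (volume.restrict (Ioi 0)).withDensity
    fun t => ENNReal.ofReal (F.real (Ioi t) / ∫ x, x ∂F)

/-- Number of arrivals in `[0, t]`, for interarrival times `w 0, w 1, …`. -/
def arrivals (w : ℕ → ℝ) (t : ℝ≥0) : ℕ :=
  Set.ncard {n : ℕ | (∑ j ∈ Finset.range (n + 1), w j) ≤ t}

/-- Claim surplus at time `t`, for interarrival times `w` and claim sizes `c`, with premium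
rate one. -/
def surplus (w c : ℕ → ℝ) (t : ℝ≥0) : ℝ :=
  (∑ i ∈ Finset.range (arrivals w t), c i) - t

variable {Ω : Type*} [MeasurableSpace Ω]

/-- The random sequences `W` (interarrival times) and `U` (claim sizes) realize the
Cramér–Lundberg model on `(Ω, P)`: claims arrive according to a Poisson process of rate `lam`
(independent exponential interarrival times), claim sizes are independent with law `G`, and the
claim sizes are independent of the arrivals. -/
structure IsCramerLundberg (P : Measure Ω) (lam : ℝ) (G : Measure ℝ) (W U : ℕ → Ω → ℝ) :
    Prop where
  interarrival : ∀ i, HasLaw (W i) (expMeasure lam) P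
  claim : ∀ i, HasLaw (U i) G P
  indep : iIndepFun (Sum.elim W U) P

/-- Probability of ultimate ruin with initial capital `u`: the claim surplus ever exceeds `u`. -/
def ruinProb (P : Measure Ω) (W U : ℕ → Ω → ℝ) (u : ℝ) : ℝ :=
  P.real {ω | ∃ t : ℝ≥0, u < surplus (fun i => W i ω) (fun i => U i ω) t}

/-- Law of the supremum over `t ≥ 0` of the claim surplus (used for models in which it is almost
surely finite). -/
def supLaw (P : Measure Ω) (W U : ℕ → Ω → ℝ) : Measure ℝ :=
  P.map fun ω => ⨆ t : ℝ≥0, surplus (fun i => W i ω) (fun i => U i ω) t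

/-- `tailL νM νC νB s m r u` is the probability that
`M₀ + ⋯ + M_s + C₁ + ⋯ + C_m + B₁ + ⋯ + B_r > u`, where all summands are independent, the `Mᵢ`
have law `νM`, the `Cⱼ` have law `νC` and the `Bₗ` have law `νB`. -/
def tailL (νM νC νB : Measure ℝ) (s m r : ℕ) (u : ℝ) : ℝ :=
  ((Measure.pi fun _ : Fin (s + 1) => νM).prod
    ((Measure.pi fun _ : Fin m => νC).prod (Measure.pi fun _ : Fin r => νB))).real
    {x | u < (∑ i, x.1 i) + (∑ j, x.2.1 j) + ∑ l, x.2.2 l}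

/-- Term with index `n + 1` (so `n = 0` is the first one) of the series with factor `θ`;
`L s m r` stands for the tail of the sum at the given `u`. -/
def heavyTerm (ε δ θ : ℝ) (L : ℕ → ℕ → ℕ → ℝ) (n : ℕ) : ℝ :=
  (ε / (1 - δ)) ^ (n + 1) * ∑ k ∈ Finset.range (n + 1),
    (n.choose k : ℝ) * θ ^ k * (-δ) ^ (n - k) * (L (n + 1) (k + 1) (n - k) - L n k (n - k))

/-- Term with index `n + 1` (so `n = 0` is the first one) of the series with factor `-δ`. -/
def phaseTerm (ε δ θ : ℝ) (L : ℕ → ℕ → ℕ → ℝ) (n : ℕ) : ℝ :=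
  (ε / (1 - δ)) ^ (n + 1) * ∑ k ∈ Finset.range (n + 1),
    (n.choose k : ℝ) * θ ^ k * (-δ) ^ (n - k) * (L (n + 1) k (n + 1 - k) - L n k (n - k))

end RuinReplace

end

/-!
The idea is that the law of the maximal surplus satisfies a defective renewal equation, and that
the expansion is the Neumann series of the perturbed equation around the unperturbed one.

*Renewal equation.* Almost surely, the surplus exceeds a level if and only if the random walk
embedded at the claim epochs does, and by the strong law of large numbers that walk drifts to `-∞`
in a stable model (`ae_isRegularPath`). Conditioning on the first claim expresses the distribution
function `H` of the maximum as `H u = ∫₀^∞ λ e^{-λw} K (u + w) dw`, where `K` is the distribution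
function of the maximum plus an independent claim (`cdf_map_walkSup`). Hence `H` has right
derivative `λ (H - K)`. Integrating it, and letting `u → ∞` to find `H 0`, gives
`H u = 1 - ρ + λ ∫₀^u G(t, ∞) H (u - t) dt` (`cdf_eq_of_first_step`). For the mixed claim law, in
operator notation with convolution by the excess laws `νB` and `νC`, this reads
`(1 - (1 - ε) δ νB - ε θ νC) H = 1 - ρ` on `[0, ∞)`; for the replace model it reads
`(1 - δ νB) H₀ = 1 - δ`.

*Expansion.* Let `νM` be the law of the maximum in the replace model, and let `A n` be the
distribution function of the signed measure `νM^(n+1) ∗ (θ νC - δ νB)ⁿ`, powers being convolution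
powers. By the renewal equation of the replace model,
`(1 - δ νB) A (n + 1) = (1 - δ) (θ νC - δ νB) A n` (`mixedSum_diag_succ`). With `x = ε / (1 - δ)`,
the sum `S = ∑ xⁿ A n` therefore satisfies
`(1 - δ νB) S = 1 - δ + ε (θ νC - δ νB) S`, so that a multiple of `S` solves the renewal equation
of the perturbed model. A locally bounded solution is unique because the total mass of the kernel
is `ρ < 1` (`eq_zero_of_renewal`). Pascal's rule turns the sum into the two series of the theorem
(`exists_hasSum_terms`).

*Convergence.* Excess laws have bounded densities, so their Laplace transforms tend to zero at
infinity, and a Chernoff bound at a large parameter (`sumCdf_le`) shows that the probability that a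
sum with `n` excess variables stays below `u` decays faster than any geometric sequence. As all the
laws have the same total mass, differences of tails are differences of distribution functions, and
both series converge absolutely whenever `δ < 1`. The bound on `ε` in the second part, together with
stability of the perturbed model, serves to guarantee `δ < 1` (`load_lt_one_of_lt_div`).
-/

namespace RuinReplace

/-! ### Distribution functions, convolutions and exponential laws -/

lemma integrable_of_measurable_of_abs_le {α : Type*} [MeasurableSpace α] {μ : Measure α}
    [IsFiniteMeasure μ] {f : α → ℝ} (hf : Measurable f) {c : ℝ} (hc : ∀ x, |f x| ≤ c) :
    Integrable f μ :=
  Integrable.of_bound hf.aestronglyMeasurable c (ae_of_all _ hc)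

lemma abs_cdf_le_one (μ : Measure ℝ) (x : ℝ) : |cdf μ x| ≤ 1 := by
  rw [abs_of_nonneg (cdf_nonneg μ x)]
  exact cdf_le_one μ x

lemma measurable_cdf (μ : Measure ℝ) : Measurable (cdf μ) := (monotone_cdf μ).measurable

lemma cdf_eq_zero_of_neg {μ : Measure ℝ} [IsProbabilityMeasure μ] (hμ : μ (Iio 0) = 0) {x : ℝ}
    (hx : x < 0) : cdf μ x = 0 := by
  rw [cdf_eq_real, measureReal_def, measure_mono_null (Iic_subset_Iio.2 hx) hμ]
  rfl

lemma ae_nonneg_of_measure_Iio {μ : Measure ℝ} (hμ : μ (Iio 0) = 0) : ∀ᵐ x ∂μ, 0 ≤ x := by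
  rw [ae_iff]
  convert hμ using 2
  ext x
  simp

lemma measurable_measureReal_Ioi (μ : Measure ℝ) [IsFiniteMeasure μ] :
    Measurable fun t => μ.real (Ioi t) :=
  Antitone.measurable fun _ _ h => measureReal_mono (Ioi_subset_Ioi h)

lemma cdf_conv (μ ν : Measure ℝ) [IsProbabilityMeasure μ] [IsProbabilityMeasure ν] (u : ℝ) :
    cdf (μ ∗ ν) u = ∫ y, cdf ν (u - y) ∂μ := by
  have h : (μ ∗ ν).real (Iic u) = ∫ z, (Iic u).indicator 1 z ∂(μ ∗ ν) :=
    (integral_indicator_one measurableSet_Iic).symm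
  rw [cdf_eq_real, h, integral_conv]
  · refine integral_congr_ae (ae_of_all _ fun y => ?_)
    dsimp only
    rw [cdf_eq_real, ← integral_indicator_one measurableSet_Iic]
    refine integral_congr_ae (ae_of_all _ fun z => ?_)
    simp only [indicator, mem_Iic, le_sub_iff_add_le, add_comm z y, Pi.one_apply]
  · exact (integrable_const (1 : ℝ)).indicator measurableSet_Iic

lemma conv_Iio_zero {μ ν : Measure ℝ} [SFinite μ] [SFinite ν] (hμ : μ (Iio 0) = 0)
    (hν : ν (Iio 0) = 0) : (μ ∗ ν) (Iio 0) = 0 := by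
  have h : ∀ᵐ z ∂(μ ∗ ν), 0 ≤ z := by
    rw [Measure.conv, ae_map_iff (by fun_prop) measurableSet_Ici]
    have h1 := Measure.ae_prod_mem_iff_ae_ae_mem (μ := μ) (ν := ν)
      (s := {x : ℝ × ℝ | 0 ≤ x.1 + x.2}) (measurableSet_le (by fun_prop) (by fun_prop))
    refine h1.2 ?_
    filter_upwards [ae_nonneg_of_measure_Iio hμ] with x hx
    filter_upwards [ae_nonneg_of_measure_Iio hν] with y hy
    exact add_nonneg hx hy
  rw [ae_iff] at h
  convert h using 2
  ext x
  simp

lemma integral_expMeasure {lam : ℝ} (hlam : 0 < lam) (f : ℝ → ℝ) :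
    ∫ w, f w ∂(expMeasure lam) = ∫ w in Ioi 0, lam * Real.exp (-(lam * w)) * f w := by
  have h0 : expMeasure lam = volume.withDensity (exponentialPDF lam) := rfl
  have hm : Measurable (exponentialPDF lam) :=
    (measurable_exponentialPDFReal lam).ennreal_ofReal
  rw [h0, integral_withDensity_eq_integral_toReal_smul hm
    (ae_of_all _ fun x => ENNReal.ofReal_lt_top), ← integral_Ici_eq_integral_Ioi,
    ← integral_indicator measurableSet_Ici]
  refine integral_congr_ae (ae_of_all _ fun x => ?_)
  simp only [exponentialPDF_eq, indicator, mem_Ici, smul_eq_mul]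
  split_ifs with h
  · rw [ENNReal.toReal_ofReal (by positivity)]
  · simp

lemma expMeasure_Iio_zero {lam : ℝ} : expMeasure lam (Iio 0) = 0 := by
  have h0 : expMeasure lam = volume.withDensity (exponentialPDF lam) := rfl
  rw [h0, withDensity_apply _ measurableSet_Iio]
  exact lintegral_exponentialPDF_of_nonpos le_rfl

lemma integrableOn_mul_exp_neg {lam : ℝ} (hlam : 0 < lam) :
    IntegrableOn (fun w => lam * Real.exp (-(lam * w))) (Ioi 0) := by
  have h := (integrableOn_exp_mul_Ioi (a := -lam) (by linarith) 0).const_mul lam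
  simpa [neg_mul, IntegrableOn] using h

lemma integrable_id_expMeasure {lam : ℝ} (hlam : 0 < lam) :
    Integrable (fun w : ℝ => w) (expMeasure lam) := by
  have h0 : expMeasure lam = volume.withDensity (exponentialPDF lam) := rfl
  have hm : Measurable (exponentialPDF lam) :=
    (measurable_exponentialPDFReal lam).ennreal_ofReal
  rw [h0, integrable_withDensity_iff_integrable_smul' hm
    (ae_of_all _ fun x => ENNReal.ofReal_lt_top)]
  have h1 : IntegrableOn (fun w : ℝ => lam * (w ^ (1 : ℝ) * Real.exp (-lam * w))) (Ioi 0) :=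
    (integrableOn_rpow_mul_exp_neg_mul_rpow (s := 1) (p := 1) (by norm_num) one_pos hlam
      |>.congr_fun (fun x _ => by simp) measurableSet_Ioi).const_mul lam
  have h2 := ((integrableOn_Ici_iff_integrableOn_Ioi (by finiteness)).2 h1).integrable_indicator
    measurableSet_Ici
  refine h2.congr (ae_of_all _ fun x => ?_)
  simp only [exponentialPDF_eq, indicator, mem_Ici, smul_eq_mul]
  split_ifs with h
  · rw [ENNReal.toReal_ofReal (by positivity), Real.rpow_one]
    ring_nf
  · simp

lemma integral_id_expMeasure {lam : ℝ} (hlam : 0 < lam) :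
    ∫ w, w ∂(expMeasure lam) = 1 / lam := by
  rw [integral_expMeasure hlam]
  have h := Real.integral_rpow_mul_exp_neg_mul_Ioi (a := 2) (r := lam) (by norm_num) hlam
  have h2 : ∀ w : ℝ, lam * Real.exp (-(lam * w)) * w
      = lam * (w ^ ((2 : ℝ) - 1) * Real.exp (-(lam * w))) := by
    intro w
    rw [show (2 : ℝ) - 1 = 1 by norm_num, Real.rpow_one]
    ring
  simp_rw [h2]
  rw [integral_const_mul, h, Real.Gamma_two]
  rw [Real.rpow_two]
  field_simp

/-! ### Stationary excess laws -/

lemma integral_id_eq_integral_Ioi {F : Measure ℝ} [IsProbabilityMeasure F]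
    (hF0 : F (Iio 0) = 0) (hF : Integrable (fun x : ℝ => x) F) :
    ∫ x, x ∂F = ∫ t in Ioi 0, F.real (Ioi t) :=
  hF.integral_eq_integral_meas_lt (ae_nonneg_of_measure_Iio hF0)

lemma integrableOn_measureReal_Ioi {F : Measure ℝ} [IsProbabilityMeasure F]
    (hF0 : F (Iio 0) = 0) (hF : Integrable (fun x : ℝ => x) F) :
    IntegrableOn (fun t => F.real (Ioi t)) (Ioi 0) := by
  refine ⟨(measurable_measureReal_Ioi F).aestronglyMeasurable, ?_⟩
  have h := lintegral_eq_lintegral_meas_lt F (ae_nonneg_of_measure_Iio hF0) hF.aemeasurable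
  have h1 : ∫⁻ x, ENNReal.ofReal x ∂F < ⊤ := hF.lintegral_lt_top
  rw [h] at h1
  refine lt_of_le_of_lt (lintegral_mono fun t => ?_) h1
  rw [Real.enorm_eq_ofReal measureReal_nonneg, measureReal_def, ENNReal.ofReal_toReal
    (measure_ne_top _ _)]
  rfl

lemma measurable_excess_density (F : Measure ℝ) [IsFiniteMeasure F] :
    Measurable fun t => ENNReal.ofReal (F.real (Ioi t) / ∫ x, x ∂F) :=
  ((measurable_measureReal_Ioi F).div_const _).ennreal_ofReal

lemma excess_Iio_zero (F : Measure ℝ) : excess F (Iio 0) = 0 := by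
  have h : (volume.restrict (Ioi (0 : ℝ))) (Iio 0) = 0 := by
    rw [Measure.restrict_apply measurableSet_Iio]
    convert measure_empty (μ := volume) using 2
    ext x
    simp only [mem_inter_iff, mem_Iio, mem_Ioi, mem_empty_iff_false, iff_false, not_and, not_lt]
    exact fun h => h.le
  exact withDensity_absolutelyContinuous _ _ h

lemma isProbabilityMeasure_excess {F : Measure ℝ} [IsProbabilityMeasure F]
    (hF0 : F (Iio 0) = 0) (hF : Integrable (fun x : ℝ => x) F) (hpos : 0 < ∫ x, x ∂F) :
    IsProbabilityMeasure (excess F) := by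
  constructor
  rw [excess, withDensity_apply _ MeasurableSet.univ, Measure.restrict_univ,
    ← ofReal_integral_eq_lintegral_ofReal]
  · rw [integral_div, ← integral_id_eq_integral_Ioi hF0 hF, div_self hpos.ne', ENNReal.ofReal_one]
  · exact (integrableOn_measureReal_Ioi hF0 hF).div_const _
  · exact ae_of_all _ fun t => div_nonneg measureReal_nonneg hpos.le

lemma integral_excess {F : Measure ℝ} [IsProbabilityMeasure F] (hpos : 0 < ∫ x, x ∂F)
    (f : ℝ → ℝ) :
    (∫ x, x ∂F) * ∫ y, f y ∂(excess F) = ∫ t in Ioi 0, F.real (Ioi t) * f t := by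
  rw [excess, integral_withDensity_eq_integral_toReal_smul (measurable_excess_density F)
    (ae_of_all _ fun x => ENNReal.ofReal_lt_top), ← integral_const_mul]
  refine integral_congr_ae (ae_of_all _ fun t => ?_)
  dsimp only
  rw [ENNReal.toReal_ofReal (div_nonneg measureReal_nonneg hpos.le), smul_eq_mul]
  field_simp

/-- The Laplace transform of an excess law decays at least like `1 / s`, because its density is
bounded. -/
lemma integral_exp_neg_excess_le {F : Measure ℝ} [IsProbabilityMeasure F]
    (hpos : 0 < ∫ x, x ∂F) {s : ℝ} (hs : 0 < s) :
    ∫ y, Real.exp (-(s * y)) ∂(excess F) ≤ 1 / (∫ x, x ∂F) / s := by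
  have h := integral_excess hpos fun y => Real.exp (-(s * y))
  have h1 : IntegrableOn (fun t : ℝ => Real.exp (-(s * t))) (Ioi 0) := by
    simpa [neg_mul] using integrableOn_exp_mul_Ioi (a := -s) (by linarith) 0
  have h2 : ∫ t in Ioi 0, F.real (Ioi t) * Real.exp (-(s * t))
      ≤ ∫ t in Ioi 0, Real.exp (-(s * t)) := by
    refine integral_mono_of_nonneg (ae_of_all _ fun t => by positivity) h1
      (ae_of_all _ fun t => ?_)
    exact mul_le_of_le_one_left (Real.exp_pos _).le measureReal_le_one
  have h3 : ∫ t in Ioi 0, Real.exp (-(s * t)) = 1 / s := by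
    have := integral_exp_mul_Ioi (a := -s) (by linarith) 0
    simp only [neg_mul, mul_zero, Real.exp_zero] at this
    rw [this]
    field_simp
  rw [← h, h3] at h2
  rw [div_div, le_div_iff₀ (by positivity)]
  rw [le_div_iff₀ hs] at h2
  linarith

/-! ### The renewal equation for the supremum -/

lemma intervalIntegrable_of_measurable_of_abs_le {f : ℝ → ℝ} (hf : Measurable f) {c : ℝ}
    (hc : ∀ x, |f x| ≤ c) (a b : ℝ) : IntervalIntegrable f volume a b := by
  rw [intervalIntegrable_iff]
  exact Measure.integrableOn_of_bounded (M := c) (by simp) hf.aestronglyMeasurable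
    (ae_of_all _ hc)

/-- Write `H` and `K` for the distribution functions of `ν` and `G ∗ ν`, and `I` for the primitive
`I x = ∫₀ˣ H`. The left-hand side is `∫ (I u - I (u - y)) G(dy)`, and Fubini's theorem turns it into
the right-hand side. -/
lemma integral_sub_integral_conv (ν G : Measure ℝ) [IsProbabilityMeasure ν]
    [IsProbabilityMeasure G] (hν0 : ν (Iio 0) = 0) (hG0 : G (Iio 0) = 0) {u : ℝ} (hu : 0 ≤ u) :
    (∫ v in 0..u, (cdf ν v - cdf (G ∗ ν) v))
      = ∫ t in Ioi 0, G.real (Ioi t) * cdf ν (u - t) := by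
  have hI : ∀ (f : ℝ → ℝ), Measurable f → (∀ x, |f x| ≤ 1) → ∀ a b,
      IntervalIntegrable f volume a b :=
    fun f hf hb a b => intervalIntegrable_of_measurable_of_abs_le hf hb a b
  have hIH : ∀ a b, IntervalIntegrable (cdf ν) volume a b :=
    hI _ (measurable_cdf ν) (abs_cdf_le_one ν)
  have hHu : IntegrableOn (fun t => cdf ν (u - t)) (Ioi 0) := by
    have h1 : IntegrableOn (fun t => cdf ν (u - t)) (Ioc 0 u) :=
      (intervalIntegrable_iff_integrableOn_Ioc_of_le hu).1
        (hI (fun t => cdf ν (u - t)) ((measurable_cdf ν).comp (by fun_prop))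
          (fun x => abs_cdf_le_one ν _) 0 u)
    have h2 : IntegrableOn (fun t => cdf ν (u - t)) (Ioi u) := by
      refine (integrableOn_zero).congr_fun (fun t ht => ?_) measurableSet_Ioi
      exact (cdf_eq_zero_of_neg hν0 (by simpa using ht)).symm
    rw [← Ioc_union_Ioi_eq_Ioi hu]
    exact h1.union h2
  -- Both sides are the integral over `y` and `t` of `1{t < y} H(u - t)`.
  have hF : Integrable (Function.uncurry fun (y t : ℝ) =>
      (if t < y then (1 : ℝ) else 0) * cdf ν (u - t)) (G.prod (volume.restrict (Ioi 0))) := by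
    have h1 : Integrable (fun p : ℝ × ℝ => cdf ν (u - p.2)) (G.prod (volume.restrict (Ioi 0))) :=
      hHu.comp_snd G
    refine h1.bdd_mul (c := 1) (f := fun p : ℝ × ℝ => if p.2 < p.1 then (1 : ℝ) else 0) ?_ ?_
    · exact (Measurable.ite (measurableSet_lt measurable_snd measurable_fst) measurable_const
        measurable_const).aestronglyMeasurable
    · refine ae_of_all _ fun p => ?_
      split_ifs <;> simp
  have hswap := integral_integral_swap hF
  have hR : ∀ t : ℝ, ∫ y, (if t < y then (1 : ℝ) else 0) * cdf ν (u - t) ∂G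
      = G.real (Ioi t) * cdf ν (u - t) := by
    intro t
    rw [integral_mul_const, ← integral_indicator_one measurableSet_Ioi]
    rfl
  have hL : ∀ᵐ y ∂G, ∫ t in Ioi 0, (if t < y then (1 : ℝ) else 0) * cdf ν (u - t)
      = (∫ v in 0..u, cdf ν v) - ∫ v in 0..u, cdf ν (v - y) := by
    filter_upwards [ae_nonneg_of_measure_Iio hG0] with y hy
    have e1 : ∫ t in Ioi 0, (if t < y then (1 : ℝ) else 0) * cdf ν (u - t)
        = ∫ t in 0..y, cdf ν (u - t) := by
      rw [intervalIntegral.integral_of_le hy, integral_Ioc_eq_integral_Ioo,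
        ← integral_indicator measurableSet_Ioi, ← integral_indicator measurableSet_Ioo]
      refine integral_congr_ae (ae_of_all _ fun t => ?_)
      by_cases h1 : 0 < t <;> by_cases h2 : t < y <;> simp [indicator, h1, h2]
    have e2 : ∫ v in (0 - y)..0, cdf ν v = 0 := by
      rw [intervalIntegral.integral_of_le (by linarith), integral_Ioc_eq_integral_Ioo]
      refine setIntegral_eq_zero_of_forall_eq_zero fun v hv => ?_
      exact cdf_eq_zero_of_neg hν0 hv.2
    rw [e1, intervalIntegral.integral_comp_sub_left, intervalIntegral.integral_comp_sub_right,
      sub_zero, ← intervalIntegral.integral_add_adjacent_intervals (hIH (0 - y) 0) (hIH 0 (u - y)),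
      e2, zero_add, intervalIntegral.integral_interval_sub_left (hIH _ _) (hIH _ _)]
  have hK : ∫ v in 0..u, cdf (G ∗ ν) v = ∫ y, (∫ v in 0..u, cdf ν (v - y)) ∂G := by
    simp_rw [cdf_conv G ν]
    rw [intervalIntegral.integral_of_le hu]
    rw [integral_integral_swap]
    · refine integral_congr_ae (ae_of_all _ fun y => ?_)
      dsimp only
      rw [intervalIntegral.integral_of_le hu]
    · exact integrable_of_measurable_of_abs_le
        ((measurable_cdf ν).comp (measurable_fst.sub measurable_snd))
        (fun p => abs_cdf_le_one ν _)
  rw [intervalIntegral.integral_sub (hIH _ _)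
    (hI _ (measurable_cdf _) (abs_cdf_le_one _) _ _), hK]
  simp_rw [hR] at hswap
  rw [← hswap, integral_congr_ae hL, integral_sub, integral_const]
  · simp
  · exact integrable_const _
  · refine Integrable.of_bound (C := u) ?_ (ae_of_all _ fun y => ?_)
    · simp_rw [intervalIntegral.integral_of_le hu]
      have hm : StronglyMeasurable (Function.uncurry fun (y v : ℝ) => cdf ν (v - y)) :=
        ((measurable_cdf ν).comp (measurable_snd.sub measurable_fst)).stronglyMeasurable
      exact (hm.integral_prod_right (ν := volume.restrict (Ioc 0 u))).aestronglyMeasurable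
    · have := intervalIntegral.norm_integral_le_of_norm_le_const (a := 0) (b := u) (C := 1)
        (f := fun v => cdf ν (v - y)) (fun v _ => abs_cdf_le_one ν _)
      simpa [abs_of_nonneg hu] using this

/-- If the distribution function `H` of `ν` satisfies the equation obtained by conditioning on the
first claim, `H u = ∫₀^∞ λ e^{-λw} K (u + w) dw` with `K` the distribution function of `G ∗ ν`,
then `H` has right derivative `λ (H - K)`, and so is the integral of it. -/
lemma cdf_sub_cdf_zero_of_first_step {lam : ℝ} (hlam : 0 < lam) {ν G : Measure ℝ}
    [IsProbabilityMeasure ν] [IsProbabilityMeasure G]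
    (hstep : ∀ u, 0 ≤ u → cdf ν u = ∫ w, cdf (G ∗ ν) (u + w) ∂(expMeasure lam))
    {u : ℝ} (hu : 0 ≤ u) :
    cdf ν u - cdf ν 0 = lam * ∫ v in 0..u, (cdf ν v - cdf (G ∗ ν) v) := by
  set K := cdf (G ∗ ν) with hKdef
  set g : ℝ → ℝ := fun v => lam * Real.exp (-(lam * v)) * K v with hg
  have hgm : Measurable g := by
    have := measurable_cdf (G ∗ ν)
    fun_prop
  have hgint : IntegrableOn g (Ioi 0) := by
    have h := (integrableOn_mul_exp_neg hlam).bdd_mul (c := 1) (f := K)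
      (measurable_cdf _).aestronglyMeasurable (ae_of_all _ fun x => abs_cdf_le_one _ _)
    refine h.congr (ae_of_all _ fun x => ?_)
    simp only [hg, mul_comm]
  have hgI : ∀ a b, 0 ≤ a → 0 ≤ b → IntervalIntegrable g volume a b := by
    intro a b ha hb
    rw [intervalIntegrable_iff]
    refine hgint.mono_set fun x hx => ?_
    exact lt_of_le_of_lt (le_min ha hb) hx.1
  have hH : ∀ u, 0 ≤ u → cdf ν u
      = Real.exp (lam * u) * ((∫ v in Ioi 0, g v) - ∫ v in 0..u, g v) := by
    intro u hu
    rw [hstep u hu, integral_expMeasure hlam]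
    have h1 := intervalIntegral.integral_interval_add_Ioi hgint
      (hgint.mono_set (Ioi_subset_Ioi hu))
    have h2 : ∫ w in Ioi 0, lam * Real.exp (-(lam * w)) * K (u + w)
        = Real.exp (lam * u) * ∫ w in Ioi 0, g (w + u) := by
      rw [← integral_const_mul]
      refine integral_congr_ae (ae_of_all _ fun w => ?_)
      simp only [hg]
      rw [mul_add, neg_add, Real.exp_add, Real.exp_neg (lam * u), add_comm w u]
      field_simp
    have h3 : ∫ w in Ioi 0, g (w + u) = ∫ v in Ioi u, g v := by
      have := (measurePreserving_add_right volume u).setIntegral_preimage_emb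
        (measurableEmbedding_addRight u) g (Ioi u)
      simpa using this
    rw [h2, h3, ← h1]
    ring
  have hcont : ContinuousOn (cdf ν) (Icc 0 u) := by
    have h1 : ContinuousOn (fun v => Real.exp (lam * v)
        * ((∫ v in Ioi 0, g v) - ∫ v in 0..v, g v)) (Icc 0 u) := by
      refine ContinuousOn.mul (by fun_prop) (ContinuousOn.sub continuousOn_const ?_)
      have := intervalIntegral.continuousOn_primitive_interval (f := g) (a := 0) (b := u)
        (μ := volume) ?_
      · rwa [uIcc_of_le hu] at this
      · rw [uIcc_of_le hu]
        exact (integrableOn_Icc_iff_integrableOn_Ioc (by finiteness)).2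
          (hgint.mono_set Ioc_subset_Ioi_self)
    exact h1.congr fun v hv => hH v hv.1
  have hderiv : ∀ v ∈ Ioo (min 0 u) (max 0 u),
      HasDerivWithinAt (cdf ν) (lam * (cdf ν v - K v)) (Ioi v) v := by
    intro v hv
    rw [min_eq_left hu, max_eq_right hu] at hv
    have hgc : ContinuousWithinAt g (Ioi v) v := by
      have h0 : ContinuousWithinAt K (Ioi v) v := ((K.right_continuous v).mono Ioi_subset_Ici_self)
      have h1 : ContinuousWithinAt (fun v => lam * Real.exp (-(lam * v))) (Ioi v) v := by
        fun_prop
      exact h1.mul h0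
    have hd1 : HasDerivWithinAt (fun x => ∫ y in 0..x, g y) (g v) (Ioi v) v :=
      (intervalIntegral.integral_hasDerivWithinAt_right (s := Ici v) (hgI 0 v le_rfl hv.1.le)
        (hgm.stronglyMeasurable.stronglyMeasurableAtFilter) hgc).mono Ioi_subset_Ici_self
    have hd2 : HasDerivWithinAt (fun x => Real.exp (lam * x)) (Real.exp (lam * v) * lam)
        (Ioi v) v := by
      have := ((hasDerivAt_id v).const_mul lam).exp.hasDerivWithinAt (s := Ioi v)
      simpa using this
    have hd := hd2.mul (hd1.const_sub (∫ v in Ioi 0, g v))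
    have hd' := hd.congr (f₁ := cdf ν) (fun x hx => hH x (hv.1.le.trans (le_of_lt hx)))
      (hH v hv.1.le)
    refine hd'.congr_deriv ?_
    rw [hH v hv.1.le]
    simp only [hg]
    rw [Real.exp_neg]
    field_simp
    ring
  have hint : IntervalIntegrable (fun v => lam * (cdf ν v - K v)) volume 0 u :=
    ((intervalIntegrable_of_measurable_of_abs_le (measurable_cdf ν) (abs_cdf_le_one ν) 0 u).sub
      (intervalIntegrable_of_measurable_of_abs_le (measurable_cdf _) (abs_cdf_le_one _) 0 u)
      ).const_mul lam
  rw [← intervalIntegral.integral_const_mul]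
  refine (intervalIntegral.integral_eq_sub_of_hasDeriv_right ?_ hderiv hint).symm
  rwa [uIcc_of_le hu]

/-- The defective renewal equation. The value at `0` is found by letting `u → ∞`. -/
theorem cdf_eq_of_first_step {lam : ℝ} (hlam : 0 < lam) {ν G : Measure ℝ}
    [IsProbabilityMeasure ν] [IsProbabilityMeasure G] (hν0 : ν (Iio 0) = 0)
    (hG0 : G (Iio 0) = 0) (hG : Integrable (fun x : ℝ => x) G)
    (hstep : ∀ u, 0 ≤ u → cdf ν u = ∫ w, cdf (G ∗ ν) (u + w) ∂(expMeasure lam))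
    {u : ℝ} (hu : 0 ≤ u) :
    cdf ν u = 1 - load lam G + lam * ∫ t in Ioi 0, G.real (Ioi t) * cdf ν (u - t) := by
  have h : ∀ u, 0 ≤ u →
      cdf ν u = cdf ν 0 + lam * ∫ t in Ioi 0, G.real (Ioi t) * cdf ν (u - t) := by
    intro u hu
    rw [← integral_sub_integral_conv ν G hν0 hG0 hu, ← cdf_sub_cdf_zero_of_first_step hlam hstep hu]
    ring
  have hlim : Tendsto (fun u => ∫ t in Ioi 0, G.real (Ioi t) * cdf ν (u - t)) atTop
      (𝓝 (∫ t in Ioi 0, G.real (Ioi t) * 1)) := by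
    refine tendsto_integral_filter_of_dominated_convergence (fun t => G.real (Ioi t)) ?_ ?_
      (integrableOn_measureReal_Ioi hG0 hG) ?_
    · refine Eventually.of_forall fun u => ?_
      exact ((measurable_measureReal_Ioi G).mul
        ((measurable_cdf ν).comp (by fun_prop))).aestronglyMeasurable
    · refine Eventually.of_forall fun u => ae_of_all _ fun t => ?_
      rw [Real.norm_eq_abs, abs_mul, abs_of_nonneg measureReal_nonneg]
      exact mul_le_of_le_one_right measureReal_nonneg (abs_cdf_le_one ν _)
    · refine ae_of_all _ fun t => Tendsto.const_mul _ ?_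
      exact (tendsto_cdf_atTop ν).comp (tendsto_atTop_add_const_right _ (-t) tendsto_id)
  simp only [mul_one] at hlim
  rw [← integral_id_eq_integral_Ioi hG0 hG] at hlim
  have h1 : Tendsto (cdf ν) atTop (𝓝 (cdf ν 0 + lam * ∫ x, x ∂G)) := by
    refine (tendsto_const_nhds.add (hlim.const_mul lam)).congr' ?_
    filter_upwards [eventually_ge_atTop 0] with u hu using (h u hu).symm
  have h2 := tendsto_nhds_unique h1 (tendsto_cdf_atTop ν)
  rw [h u hu, load]
  linarith

/-! ### Reduction of the surplus process to a random walk -/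

/-- In a path with nonnegative interarrival times whose arrival epochs tend to infinity, the number
of arrivals in `[0, t]` is the index for which `t` lies between two successive epochs. -/
lemma arrivals_spec {w : ℕ → ℝ} (hw : ∀ i, 0 ≤ w i)
    (hT : Tendsto (fun n => ∑ j ∈ Finset.range n, w j) atTop atTop) (t : ℝ≥0) (n : ℕ) :
    n < arrivals w t ↔ ∑ j ∈ Finset.range (n + 1), w j ≤ t := by
  have hmono : Monotone fun n => ∑ j ∈ Finset.range n, w j :=
    monotone_nat_of_le_succ fun n => by
      rw [Finset.sum_range_succ]
      linarith [hw n]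
  have hex : ∃ n, (t : ℝ) < ∑ j ∈ Finset.range (n + 1), w j :=
    (((tendsto_add_atTop_iff_nat 1).2 hT).eventually_gt_atTop (t : ℝ)).exists
  classical
  have hset : {n : ℕ | (∑ j ∈ Finset.range (n + 1), w j) ≤ t} = Iio (Nat.find hex) := by
    ext m
    simp only [mem_ofPred_eq, mem_Iio, Nat.lt_find_iff, not_lt]
    exact ⟨fun h k hk => (hmono (Nat.succ_le_succ hk)).trans h, fun h => h m le_rfl⟩
  have hcard : arrivals w t = Nat.find hex := by
    rw [arrivals, hset]
    simp
  rw [hcard, ← mem_Iio, ← hset, mem_ofPred_eq]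

/-- The surplus decreases between claims, so its values are exceeded at claim epochs. -/
lemma exists_lt_surplus_iff {w c : ℕ → ℝ} (hw : ∀ i, 0 ≤ w i) (hc : ∀ i, 0 ≤ c i)
    (hT : Tendsto (fun n => ∑ j ∈ Finset.range n, w j) atTop atTop) (u : ℝ) :
    (∃ t : ℝ≥0, u < surplus w c t) ↔ ∃ n, u < ∑ i ∈ Finset.range n, (c i - w i) := by
  constructor
  · rintro ⟨t, ht⟩
    refine ⟨arrivals w t, ht.trans_le ?_⟩
    rw [surplus, Finset.sum_sub_distrib]
    have h : ∑ i ∈ Finset.range (arrivals w t), w i ≤ t := by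
      rcases Nat.eq_zero_or_pos (arrivals w t) with h0 | h0
      · simp [h0]
      · have := (arrivals_spec hw hT t (arrivals w t - 1)).1 (by omega)
        rwa [Nat.sub_add_cancel h0] at this
    linarith
  · rintro ⟨n, hn⟩
    obtain ⟨t, ht⟩ : ∃ t : ℝ≥0, (t : ℝ) = ∑ i ∈ Finset.range n, w i :=
      ⟨Real.toNNReal _, Real.coe_toNNReal _ (Finset.sum_nonneg fun i _ => hw i)⟩
    refine ⟨t, hn.trans_le ?_⟩
    rw [surplus, Finset.sum_sub_distrib, ht]
    refine sub_le_sub_right ?_ _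
    refine Finset.sum_le_sum_of_subset_of_nonneg ?_ fun i _ _ => hc i
    refine Finset.range_subset_range.2 ?_
    rcases Nat.eq_zero_or_pos n with h0 | h0
    · simp [h0]
    · have := (arrivals_spec hw hT t (n - 1)).2 (by rw [Nat.sub_add_cancel h0, ht])
      omega

/-- Supremum of the random walk embedded at the claim epochs, for interarrival times
`z (inl 0), z (inl 1), …` and claim sizes `z (inr 0), z (inr 1), …`. -/
noncomputable def walkSup (z : ℕ ⊕ ℕ → ℝ) : ℝ :=
  ⨆ n : ℕ, ∑ i ∈ Finset.range n, (z (.inr i) - z (.inl i))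

/-- The paths for which the supremum over time is the supremum of the embedded walk, and is
finite. -/
structure IsRegularPath (z : ℕ ⊕ ℕ → ℝ) : Prop where
  nonneg : ∀ i, 0 ≤ z i
  epochs : Tendsto (fun n => ∑ j ∈ Finset.range n, z (.inl j)) atTop atTop
  bddAbove : BddAbove (range fun n : ℕ => ∑ i ∈ Finset.range n, (z (.inr i) - z (.inl i)))

lemma IsRegularPath.exists_lt_surplus_iff {z : ℕ ⊕ ℕ → ℝ} (hz : IsRegularPath z) (u : ℝ) :
    (∃ t : ℝ≥0, u < surplus (fun i => z (.inl i)) (fun i => z (.inr i)) t) ↔ u < walkSup z := by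
  rw [RuinReplace.exists_lt_surplus_iff (fun i => hz.nonneg _) (fun i => hz.nonneg _) hz.epochs,
    walkSup, lt_ciSup_iff hz.bddAbove]

lemma IsRegularPath.iSup_surplus {z : ℕ ⊕ ℕ → ℝ} (hz : IsRegularPath z) :
    (⨆ t : ℝ≥0, surplus (fun i => z (.inl i)) (fun i => z (.inr i)) t) = walkSup z := by
  have hle : ∀ t, surplus (fun i => z (.inl i)) (fun i => z (.inr i)) t ≤ walkSup z := by
    intro t
    by_contra! h
    exact lt_irrefl _ ((hz.exists_lt_surplus_iff _).1 ⟨t, h⟩)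
  refine le_antisymm (ciSup_le hle) ?_
  by_contra! h
  obtain ⟨t, ht⟩ := (hz.exists_lt_surplus_iff _).2 h
  exact (le_ciSup (f := fun t => surplus (fun i => z (.inl i)) (fun i => z (.inr i)) t)
    ⟨walkSup z, by rintro _ ⟨t, rfl⟩; exact hle t⟩ t).not_gt ht

lemma IsRegularPath.walkSup_nonneg {z : ℕ ⊕ ℕ → ℝ} (hz : IsRegularPath z) : 0 ≤ walkSup z := by
  have h := le_ciSup hz.bddAbove 0
  rwa [Finset.sum_range_zero] at h

lemma measurable_walkSup : Measurable walkSup := by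
  unfold walkSup
  exact Measurable.iSup fun n => by fun_prop

/-- The path after the first claim. -/
def shiftPath (z : ℕ ⊕ ℕ → ℝ) : ℕ ⊕ ℕ → ℝ := fun i => z (Sum.map Nat.succ Nat.succ i)

/-- Lindley's recursion for the supremum of the walk. -/
lemma walkSup_le_iff {z : ℕ ⊕ ℕ → ℝ} (hz : IsRegularPath z) (hz' : IsRegularPath (shiftPath z))
    {u : ℝ} (hu : 0 ≤ u) :
    walkSup z ≤ u ↔ z (.inr 0) + walkSup (shiftPath z) ≤ u + z (.inl 0) := by
  have h1 : ∀ n, ∑ i ∈ Finset.range (n + 1), (z (.inr i) - z (.inl i))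
      = (∑ i ∈ Finset.range n, (shiftPath z (.inr i) - shiftPath z (.inl i)))
        + (z (.inr 0) - z (.inl 0)) := by
    intro n
    rw [Finset.sum_range_succ']
    rfl
  have h2 : z (.inr 0) + walkSup (shiftPath z) ≤ u + z (.inl 0)
      ↔ walkSup (shiftPath z) ≤ u - (z (.inr 0) - z (.inl 0)) := by
    constructor <;> intro h <;> linarith
  rw [h2, walkSup, walkSup, ciSup_le_iff hz.bddAbove, ciSup_le_iff hz'.bddAbove]
  constructor
  · intro h n
    have := h (n + 1)
    rw [h1] at this
    linarith
  · intro h n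
    cases n with
    | zero => simpa using hu
    | succ n =>
      rw [h1]
      linarith [h n]

/-! ### Independence of the first step from the rest of the path -/

lemma infinitePi_map_prodMk {ι α : Type*} [Countable ι] [Countable α] (μ : ι → Measure ℝ)
    [∀ i, IsProbabilityMeasure (μ i)] {a : ι} {f : α → ι} (hf : Function.Injective f)
    (ha : a ∉ range f) :
    (Measure.infinitePi μ).map (fun z => (z a, fun i => z (f i)))
      = (μ a).prod (Measure.infinitePi fun i => μ (f i)) := by
  have hind : IndepFun (fun z : ι → ℝ => z a) (fun z i => z (f i)) (Measure.infinitePi μ) := by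
    have h0 : iIndepFun (fun (i : ι) (z : ι → ℝ) => z i) (Measure.infinitePi μ) :=
      iIndepFun_infinitePi (X := fun _ x => x) (by fun_prop)
    have h1 := indep_iSup_of_disjoint (fun i => (measurable_pi_apply i).comap_le) h0
      (S := {a}) (T := {a}ᶜ) disjoint_compl_right
    rw [IndepFun_iff_Indep]
    refine indep_of_indep_of_le_left (indep_of_indep_of_le_right h1 ?_) ?_
    · rw [MeasurableSpace.pi, MeasurableSpace.comap_iSup]
      refine iSup_le fun i => ?_
      rw [MeasurableSpace.comap_comp]
      exact le_iSup₂_of_le (f := fun i (_ : i ∈ ({a}ᶜ : Set ι)) =>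
        MeasurableSpace.comap (fun z : ι → ℝ => z i) inferInstance) (f i)
        (fun h => ha ⟨i, h⟩) le_rfl
    · simp
  rw [hind.map_prod_eq_prod_map_map (measurable_pi_apply a).aemeasurable
      (measurable_pi_lambda _ fun i => measurable_pi_apply (f i)).aemeasurable,
    Measure.map_infinitePi_infinitePi_of_inj hf]
  congr 1
  exact Measure.infinitePi_map_eval μ a

/-- The law of the sequences of interarrival times and claim sizes in the Cramér–Lundberg model. -/
noncomputable def pathLaw (lam : ℝ) (G : Measure ℝ) : Measure (ℕ ⊕ ℕ → ℝ) :=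
  Measure.infinitePi (Sum.elim (fun _ => expMeasure lam) fun _ => G)

lemma isProbabilityMeasure_sumElim {lam : ℝ} (hlam : 0 < lam) (G : Measure ℝ)
    [IsProbabilityMeasure G] (i : ℕ ⊕ ℕ) :
    IsProbabilityMeasure (Sum.elim (fun _ : ℕ => expMeasure lam) (fun _ : ℕ => G) i) := by
  have := isProbabilityMeasure_expMeasure hlam
  cases i <;> simpa

section pathLaw

variable {lam : ℝ} {G : Measure ℝ} [IsProbabilityMeasure G]

lemma isProbabilityMeasure_pathLaw (hlam : 0 < lam) : IsProbabilityMeasure (pathLaw lam G) := by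
  have := isProbabilityMeasure_sumElim hlam G
  unfold pathLaw
  infer_instance

lemma pathLaw_map_eval (hlam : 0 < lam) (i : ℕ ⊕ ℕ) : (pathLaw lam G).map (fun z => z i)
    = Sum.elim (fun _ => expMeasure lam) (fun _ => G) i := by
  have := isProbabilityMeasure_sumElim hlam G
  exact Measure.infinitePi_map_eval _ i

lemma pathLaw_map_shiftPath (hlam : 0 < lam) :
    (pathLaw lam G).map shiftPath = pathLaw lam G := by
  have := isProbabilityMeasure_sumElim hlam G
  have h := Measure.map_infinitePi_infinitePi_of_inj
    (P := Sum.elim (fun _ : ℕ => expMeasure lam) fun _ : ℕ => G)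
    (f := Sum.map Nat.succ Nat.succ)
    (Sum.map_injective.2 ⟨Nat.succ_injective, Nat.succ_injective⟩)
  unfold pathLaw
  refine Eq.trans h ?_
  congr 1
  ext1 i
  cases i <;> rfl

/-- The first interarrival time, the first claim size and the later path are independent. -/
lemma pathLaw_map_first (hlam : 0 < lam) :
    (pathLaw lam G).map (fun z => (z (.inl 0), z (.inr 0), shiftPath z))
      = (expMeasure lam).prod (G.prod (pathLaw lam G)) := by
  have := isProbabilityMeasure_sumElim hlam G
  have := isProbabilityMeasure_expMeasure hlam
  have := isProbabilityMeasure_pathLaw (G := G) hlam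
  set μ : ℕ ⊕ ℕ → Measure ℝ := Sum.elim (fun _ : ℕ => expMeasure lam) fun _ : ℕ => G with hμ
  let f : Option (ℕ ⊕ ℕ) → ℕ ⊕ ℕ := fun o => o.elim (.inr 0) (Sum.map Nat.succ Nat.succ)
  have hf : Function.Injective f := by
    rintro (_ | _ | _) (_ | _ | _) <;> simp [f]
  have ha : Sum.inl 0 ∉ range f := by
    rintro ⟨_ | _ | _, h⟩ <;> simp [f] at h
  have h1 := infinitePi_map_prodMk μ hf ha
  have h2 := infinitePi_map_prodMk (fun i => μ (f i)) (a := none) (f := some)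
    (Option.some_injective _) (by simp)
  have h3 : (Measure.infinitePi fun i => μ (f (some i))) = pathLaw lam G := by
    unfold pathLaw
    congr 1
    ext1 i
    cases i <;> rfl
  rw [h3] at h2
  have h4 : (fun z : ℕ ⊕ ℕ → ℝ => (z (.inl 0), z (.inr 0), shiftPath z))
      = Prod.map id (fun y : Option (ℕ ⊕ ℕ) → ℝ => (y none, fun i => y (some i)))
        ∘ fun z => (z (.inl 0), fun i => z (f i)) := rfl
  have h5 : Measurable fun y : Option (ℕ ⊕ ℕ) → ℝ => (y none, fun i => y (some i)) := by
    fun_prop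
  rw [h4, ← Measure.map_map (measurable_id.prodMap h5) (by fun_prop)]
  have h6 := Measure.map_prod_map (expMeasure lam) (Measure.infinitePi fun i => μ (f i))
    measurable_id h5
  unfold pathLaw at *
  rw [h1]
  refine h6.symm.trans ?_
  rw [h2, Measure.map_id]
  rfl

/-- By the strong law of large numbers, if the claims arriving per unit time are smaller than the
premium rate then almost every path drifts to `-∞`. -/
lemma ae_isRegularPath (hlam : 0 < lam) (hG0 : G (Iio 0) = 0)
    (hG : Integrable (fun x : ℝ => x) G) (hload : load lam G < 1) :
    ∀ᵐ z ∂(pathLaw lam G), IsRegularPath z := by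
  have := isProbabilityMeasure_sumElim hlam G
  have := isProbabilityMeasure_expMeasure hlam
  have := isProbabilityMeasure_pathLaw (G := G) hlam
  have hind : iIndepFun (fun (i : ℕ ⊕ ℕ) (z : ℕ ⊕ ℕ → ℝ) => z i) (pathLaw lam G) :=
    iIndepFun_infinitePi (X := fun _ x => x) (by fun_prop)
  have hmp : ∀ i, MeasurePreserving (fun z : ℕ ⊕ ℕ → ℝ => z i) (pathLaw lam G)
      (Sum.elim (fun _ => expMeasure lam) (fun _ => G) i) :=
    fun i => ⟨by fun_prop, pathLaw_map_eval hlam i⟩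
  have hnn : ∀ᵐ z ∂(pathLaw lam G), ∀ i, 0 ≤ z i := by
    rw [ae_all_iff]
    intro i
    refine (hmp i).quasiMeasurePreserving.ae ?_
    cases i
    · exact ae_nonneg_of_measure_Iio expMeasure_Iio_zero
    · exact ae_nonneg_of_measure_Iio hG0
  have hW := strong_law_ae_real (μ := pathLaw lam G) (fun (n : ℕ) z => z (.inl n))
    ((hmp (.inl 0)).integrable_comp_of_integrable (integrable_id_expMeasure hlam))
    (fun i j hij => hind.indepFun (by simpa using hij))
    (fun i => ⟨(measurable_pi_apply _).aemeasurable, (measurable_pi_apply _).aemeasurable, by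
      rw [(hmp _).map_eq, (hmp _).map_eq]; rfl⟩)
  have hU := strong_law_ae_real (μ := pathLaw lam G) (fun (n : ℕ) z => z (.inr n))
    ((hmp (.inr 0)).integrable_comp_of_integrable hG)
    (fun i j hij => hind.indepFun (by simpa using hij))
    (fun i => ⟨(measurable_pi_apply _).aemeasurable, (measurable_pi_apply _).aemeasurable, by
      rw [(hmp _).map_eq, (hmp _).map_eq]; rfl⟩)
  have hWm : ∫ z, z (.inl 0) ∂(pathLaw lam G) = 1 / lam := by
    rw [← integral_id_expMeasure hlam]
    exact (HasLaw.mk (measurable_pi_apply _).aemeasurable (hmp (.inl 0)).map_eq).integral_eq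
  have hUm : ∫ z, z (.inr 0) ∂(pathLaw lam G) = ∫ x, x ∂G :=
    (HasLaw.mk (measurable_pi_apply _).aemeasurable (hmp (.inr 0)).map_eq).integral_eq
  rw [hWm] at hW
  rw [hUm] at hU
  have hlin : ∀ {s : ℕ → ℝ}, ∀ᶠ n : ℕ in atTop, s n / n * n = s n := by
    intro s
    filter_upwards [eventually_gt_atTop 0] with n hn
    have : (n : ℝ) ≠ 0 := by positivity
    field_simp
  filter_upwards [hnn, hW, hU] with z h0 h1 h2
  refine ⟨h0, ?_, ?_⟩
  · exact (h1.pos_mul_atTop (by positivity) tendsto_natCast_atTop_atTop).congr' hlin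
  · have h3 : Tendsto (fun n : ℕ => (∑ i ∈ Finset.range n, (z (.inr i) - z (.inl i))) / n) atTop
        (𝓝 (∫ x, x ∂G - 1 / lam)) := by
      simpa only [Finset.sum_sub_distrib, sub_div] using h2.sub h1
    have hneg : ∫ x, x ∂G - 1 / lam < 0 := by
      rw [sub_neg, lt_div_iff₀ hlam, mul_comm]
      exact hload
    have h4 := (h3.neg_mul_atTop hneg tendsto_natCast_atTop_atTop).congr' hlin
    exact IsBoundedUnder.bddAbove_range ⟨0, (h4.eventually_le_atBot 0)⟩

lemma map_walkSup_Iio_zero (hlam : 0 < lam) (hG0 : G (Iio 0) = 0)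
    (hG : Integrable (fun x : ℝ => x) G) (hload : load lam G < 1) :
    (pathLaw lam G).map walkSup (Iio 0) = 0 := by
  have h : ∀ᵐ z ∂(pathLaw lam G), ¬ walkSup z < 0 := by
    filter_upwards [ae_isRegularPath hlam hG0 hG hload] with z hz using hz.walkSup_nonneg.not_gt
  rw [Measure.map_apply measurable_walkSup measurableSet_Iio]
  exact measure_mono_null (fun z hz => by simpa using hz) (ae_iff.1 h)

/-- Conditioning on the first claim. -/
lemma cdf_map_walkSup (hlam : 0 < lam) (hG0 : G (Iio 0) = 0)
    (hG : Integrable (fun x : ℝ => x) G) (hload : load lam G < 1) {u : ℝ} (hu : 0 ≤ u) :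
    cdf ((pathLaw lam G).map walkSup) u
      = ∫ w, cdf (G ∗ (pathLaw lam G).map walkSup) (u + w) ∂(expMeasure lam) := by
  have := isProbabilityMeasure_expMeasure hlam
  have := isProbabilityMeasure_pathLaw (G := G) hlam
  have : IsProbabilityMeasure ((pathLaw lam G).map walkSup) :=
    Measure.isProbabilityMeasure_map measurable_walkSup.aemeasurable
  have hreg := ae_isRegularPath hlam hG0 hG hload
  have hsm : Measurable shiftPath := by unfold shiftPath; fun_prop
  have hreg' : ∀ᵐ z ∂(pathLaw lam G), IsRegularPath (shiftPath z) := by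
    have h : ∀ᵐ z ∂((pathLaw lam G).map shiftPath), IsRegularPath z := by
      rwa [pathLaw_map_shiftPath hlam]
    exact ae_of_ae_map hsm.aemeasurable h
  let s : Set (ℝ × ℝ × (ℕ ⊕ ℕ → ℝ)) := {p | p.2.1 + walkSup p.2.2 ≤ u + p.1}
  have hs : MeasurableSet s := by
    have := measurable_walkSup
    exact measurableSet_le (by fun_prop) (by fun_prop)
  have h1 : (pathLaw lam G).real (walkSup ⁻¹' Iic u)
      = (pathLaw lam G).real ((fun z => (z (.inl 0), z (.inr 0), shiftPath z)) ⁻¹' s) := by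
    refine measureReal_congr ?_
    filter_upwards [hreg, hreg'] with z hz hz'
    exact propext (walkSup_le_iff hz hz' hu)
  rw [cdf_eq_real, map_measureReal_apply measurable_walkSup measurableSet_Iic, h1,
    ← map_measureReal_apply (by fun_prop) hs, pathLaw_map_first hlam,
    ← integral_indicator_one hs, integral_prod]
  · refine integral_congr_ae (ae_of_all _ fun w => ?_)
    dsimp only
    have h2 := Measure.map_prod_map G (pathLaw lam G) measurable_id measurable_walkSup
    rw [Measure.map_id] at h2
    rw [cdf_eq_real, Measure.conv, h2,
      Measure.map_map (by fun_prop) (measurable_id.prodMap measurable_walkSup),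
      map_measureReal_apply (Measurable.comp (by fun_prop)
        (measurable_id.prodMap measurable_walkSup)) measurableSet_Iic,
      ← integral_indicator_one]
    · rfl
    · exact (Measurable.comp (by fun_prop)
        (measurable_id.prodMap measurable_walkSup)) measurableSet_Iic
  · exact (integrable_const (1 : ℝ)).indicator hs

end pathLaw

lemma IsCramerLundberg.hasLaw_path {Ω : Type*} [MeasurableSpace Ω] {P : Measure Ω} {lam : ℝ}
    {G : Measure ℝ} {W U : ℕ → Ω → ℝ} (h : IsCramerLundberg P lam G W U) :
    HasLaw (fun ω i => Sum.elim W U i ω) (pathLaw lam G) P := by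
  have h1 : ∀ i, HasLaw (Sum.elim W U i) (Sum.elim (fun _ => expMeasure lam) (fun _ => G) i) P := by
    rintro (i | i)
    · exact h.interarrival i
    · exact h.claim i
  exact h.indep.hasLaw_infinitePi h1 (aemeasurable_pi_iff.2 fun i => (h1 i).aemeasurable)

section IsCramerLundberg

variable {Ω : Type*} [MeasurableSpace Ω] {P : Measure Ω} {lam : ℝ} {G : Measure ℝ}
  [IsProbabilityMeasure G] {W U : ℕ → Ω → ℝ}

lemma IsCramerLundberg.ae_isRegularPath (h : IsCramerLundberg P lam G W U) (hlam : 0 < lam)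
    (hG0 : G (Iio 0) = 0) (hG : Integrable (fun x : ℝ => x) G) (hload : load lam G < 1) :
    ∀ᵐ ω ∂P, IsRegularPath fun i => Sum.elim W U i ω := by
  have h1 := RuinReplace.ae_isRegularPath hlam hG0 hG hload
  rw [← h.hasLaw_path.map_eq] at h1
  exact ae_of_ae_map h.hasLaw_path.aemeasurable h1

lemma IsCramerLundberg.supLaw_eq (h : IsCramerLundberg P lam G W U) (hlam : 0 < lam)
    (hG0 : G (Iio 0) = 0) (hG : Integrable (fun x : ℝ => x) G) (hload : load lam G < 1) :
    supLaw P W U = (pathLaw lam G).map walkSup := by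
  rw [← h.hasLaw_path.map_eq, AEMeasurable.map_map_of_aemeasurable
    measurable_walkSup.aemeasurable h.hasLaw_path.aemeasurable, supLaw]
  refine Measure.map_congr ?_
  filter_upwards [h.ae_isRegularPath hlam hG0 hG hload] with ω hω
  exact hω.iSup_surplus

lemma IsCramerLundberg.ruinProb_eq (h : IsCramerLundberg P lam G W U) (hlam : 0 < lam)
    (hG0 : G (Iio 0) = 0) (hG : Integrable (fun x : ℝ => x) G) (hload : load lam G < 1) (u : ℝ) :
    ruinProb P W U u = (supLaw P W U).real (Ioi u) := by
  rw [h.supLaw_eq hlam hG0 hG hload, map_measureReal_apply measurable_walkSup measurableSet_Ioi,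
    ← h.hasLaw_path.map_eq, map_measureReal_apply_of_aemeasurable h.hasLaw_path.aemeasurable
    (measurable_walkSup measurableSet_Ioi), ruinProb]
  refine measureReal_congr ?_
  filter_upwards [h.ae_isRegularPath hlam hG0 hG hload] with ω hω
  exact propext (hω.exists_lt_surplus_iff u)

/-- The law of the maximal surplus is a probability law on `[0, ∞)` whose distribution function
satisfies the defective renewal equation. -/
theorem IsCramerLundberg.supLaw_spec (h : IsCramerLundberg P lam G W U) (hlam : 0 < lam)
    (hG0 : G (Iio 0) = 0) (hG : Integrable (fun x : ℝ => x) G) (hload : load lam G < 1) :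
    IsProbabilityMeasure (supLaw P W U) ∧ supLaw P W U (Iio 0) = 0 ∧
    ∀ u, 0 ≤ u → cdf (supLaw P W U) u = 1 - load lam G
      + lam * ∫ t in Ioi 0, G.real (Ioi t) * cdf (supLaw P W U) (u - t) := by
  rw [h.supLaw_eq hlam hG0 hG hload]
  have := isProbabilityMeasure_pathLaw (G := G) hlam
  have : IsProbabilityMeasure ((pathLaw lam G).map walkSup) :=
    Measure.isProbabilityMeasure_map measurable_walkSup.aemeasurable
  have h0 := map_walkSup_Iio_zero hlam hG0 hG hload
  exact ⟨this, h0, fun u hu => cdf_eq_of_first_step hlam h0 hG0 hG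
    (fun u hu => cdf_map_walkSup hlam hG0 hG hload hu) hu⟩

end IsCramerLundberg

/-! ### Laws of sums of independent variables -/

/-- The `n`-fold convolution power of `ν`. -/
noncomputable def convPow (ν : Measure ℝ) : ℕ → Measure ℝ
  | 0 => Measure.dirac 0
  | n + 1 => ν ∗ convPow ν n

lemma convPow_succ (ν : Measure ℝ) (n : ℕ) : convPow ν (n + 1) = ν ∗ convPow ν n := rfl

lemma isProbabilityMeasure_convPow (ν : Measure ℝ) [IsProbabilityMeasure ν] (n : ℕ) :
    IsProbabilityMeasure (convPow ν n) := by
  induction n with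
  | zero => exact Measure.dirac.isProbabilityMeasure
  | succ n ih => unfold convPow; infer_instance

lemma convPow_Iio_zero {ν : Measure ℝ} [IsProbabilityMeasure ν] (hν : ν (Iio 0) = 0) (n : ℕ) :
    convPow ν n (Iio 0) = 0 := by
  induction n with
  | zero => simp [convPow]
  | succ n ih =>
    have := isProbabilityMeasure_convPow ν n
    exact conv_Iio_zero hν ih

lemma map_sum_pi (ν : Measure ℝ) [IsProbabilityMeasure ν] (n : ℕ) :
    (Measure.pi fun _ : Fin n => ν).map (fun x => ∑ i, x i) = convPow ν n := by
  induction n with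
  | zero => simp [convPow, Measure.map_const]
  | succ n ih =>
    have := isProbabilityMeasure_convPow ν n
    have hm : Measurable fun x : Fin n → ℝ => ∑ i, x i := by fun_prop
    have h1 := (measurePreserving_piFinSuccAbove (fun _ : Fin (n + 1) => ν) 0).map_eq
    have h2 : (fun x : Fin (n + 1) → ℝ => ∑ i, x i)
        = (fun p : ℝ × ℝ => p.1 + p.2) ∘ Prod.map id (fun x : Fin n → ℝ => ∑ i, x i)
          ∘ MeasurableEquiv.piFinSuccAbove (fun _ : Fin (n + 1) => ℝ) 0 := by
      ext x
      simp [Fin.sum_univ_succ, MeasurableEquiv.piFinSuccAbove, Fin.insertNthEquiv, Fin.tail]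
    have h3 := Measure.map_prod_map ν (Measure.pi fun _ : Fin n => ν) measurable_id hm
    rw [Measure.map_id, ih] at h3
    rw [h2, ← Measure.map_map (by fun_prop) (by fun_prop),
      ← Measure.map_map (measurable_id.prodMap hm) (by fun_prop), h1, ← h3]
    rfl

/-- The law of `M₀ + ⋯ + M_s + C₁ + ⋯ + C_m + B₁ + ⋯ + B_r`. -/
noncomputable def sumLaw (νM νC νB : Measure ℝ) (s m r : ℕ) : Measure ℝ :=
  convPow νM (s + 1) ∗ (convPow νC m ∗ convPow νB r)

/-- The distribution function of `M₀ + ⋯ + M_s + C₁ + ⋯ + C_m + B₁ + ⋯ + B_r`. -/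
noncomputable def sumCdf (νM νC νB : Measure ℝ) (s m r : ℕ) (u : ℝ) : ℝ :=
  cdf (sumLaw νM νC νB s m r) u

lemma abs_sumCdf_le_one (νM νC νB : Measure ℝ) (s m r : ℕ) (u : ℝ) :
    |sumCdf νM νC νB s m r u| ≤ 1 :=
  abs_cdf_le_one _ _

lemma measurable_sumCdf (νM νC νB : Measure ℝ) (s m r : ℕ) :
    Measurable (sumCdf νM νC νB s m r) := measurable_cdf _

lemma sumCdf_zero (νM νC νB : Measure ℝ) [SFinite νM] : sumCdf νM νC νB 0 0 0 = cdf νM := by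
  have h : sumLaw νM νC νB 0 0 0 = νM := by simp [sumLaw, convPow]
  funext u
  rw [sumCdf, h]

section sumLaw

variable {νM νC νB : Measure ℝ} [IsProbabilityMeasure νM] [IsProbabilityMeasure νC]
  [IsProbabilityMeasure νB]

lemma isProbabilityMeasure_sumLaw (s m r : ℕ) : IsProbabilityMeasure (sumLaw νM νC νB s m r) := by
  have := isProbabilityMeasure_convPow νM (s + 1)
  have := isProbabilityMeasure_convPow νC m
  have := isProbabilityMeasure_convPow νB r
  unfold sumLaw
  infer_instance

lemma tailL_eq (s m r : ℕ) (u : ℝ) : tailL νM νC νB s m r u = 1 - sumCdf νM νC νB s m r u := by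
  have := isProbabilityMeasure_sumLaw (νM := νM) (νC := νC) (νB := νB) s m r
  have := isProbabilityMeasure_convPow νM (s + 1)
  have := isProbabilityMeasure_convPow νC m
  have := isProbabilityMeasure_convPow νB r
  have hM : Measurable fun x : Fin (s + 1) → ℝ => ∑ i, x i := by fun_prop
  have hC : Measurable fun x : Fin m → ℝ => ∑ i, x i := by fun_prop
  have hB : Measurable fun x : Fin r → ℝ => ∑ i, x i := by fun_prop
  have h1 := Measure.map_prod_map (Measure.pi fun _ : Fin m => νC) (Measure.pi fun _ : Fin r => νB)
    hC hB
  have h2 := Measure.map_prod_map (Measure.pi fun _ : Fin (s + 1) => νM)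
    ((Measure.pi fun _ : Fin m => νC).prod (Measure.pi fun _ : Fin r => νB)) hM (hC.prodMap hB)
  rw [← h1, map_sum_pi, map_sum_pi, map_sum_pi] at h2
  have hadd : Measurable fun p : ℝ × ℝ => p.1 + p.2 := by fun_prop
  have h3 := Measure.map_prod_map (convPow νM (s + 1)) ((convPow νC m).prod (convPow νB r))
    measurable_id hadd
  rw [Measure.map_id] at h3
  have h4 : sumLaw νM νC νB s m r = ((Measure.pi fun _ : Fin (s + 1) => νM).prod
      ((Measure.pi fun _ : Fin m => νC).prod (Measure.pi fun _ : Fin r => νB))).map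
      fun x => (∑ i, x.1 i) + ((∑ j, x.2.1 j) + ∑ l, x.2.2 l) := by
    unfold sumLaw Measure.conv
    rw [h3, Measure.map_map hadd (measurable_id.prodMap hadd), h2,
      Measure.map_map (hadd.comp (measurable_id.prodMap hadd)) (hM.prodMap (hC.prodMap hB))]
    rfl
  have h5 : tailL νM νC νB s m r u = (sumLaw νM νC νB s m r).real (Ioi u) := by
    rw [h4, map_measureReal_apply (by fun_prop) measurableSet_Ioi, tailL]
    congr 1
    ext x
    simp [add_assoc]
  rw [h5, sumCdf, cdf_eq_real, ← compl_Iic, probReal_compl_eq_one_sub measurableSet_Iic]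

lemma sumCdf_succ_phase (s m r : ℕ) (u : ℝ) :
    sumCdf νM νC νB s m (r + 1) u = ∫ y, sumCdf νM νC νB s m r (u - y) ∂νB := by
  have := isProbabilityMeasure_sumLaw (νM := νM) (νC := νC) (νB := νB) s m r
  have := isProbabilityMeasure_convPow νM (s + 1)
  have := isProbabilityMeasure_convPow νC m
  have := isProbabilityMeasure_convPow νB r
  have h : sumLaw νM νC νB s m (r + 1) = νB ∗ sumLaw νM νC νB s m r := by
    unfold sumLaw
    rw [convPow_succ νB, Measure.conv_comm νB, ← Measure.conv_assoc (convPow νC m),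
      ← Measure.conv_assoc (convPow νM _), Measure.conv_comm _ νB]
  simp only [sumCdf]
  rw [h, cdf_conv]

lemma sumCdf_succ_heavy (s m r : ℕ) (u : ℝ) :
    sumCdf νM νC νB s (m + 1) r u = ∫ y, sumCdf νM νC νB s m r (u - y) ∂νC := by
  have := isProbabilityMeasure_sumLaw (νM := νM) (νC := νC) (νB := νB) s m r
  have := isProbabilityMeasure_convPow νM (s + 1)
  have := isProbabilityMeasure_convPow νC m
  have := isProbabilityMeasure_convPow νB r
  have h : sumLaw νM νC νB s (m + 1) r = νC ∗ sumLaw νM νC νB s m r := by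
    unfold sumLaw
    rw [convPow_succ νC, Measure.conv_assoc, ← Measure.conv_assoc (convPow νM _),
      Measure.conv_comm (convPow νM _) νC, Measure.conv_assoc]
  simp only [sumCdf]
  rw [h, cdf_conv]

lemma sumCdf_of_neg (hM : νM (Iio 0) = 0) (hC : νC (Iio 0) = 0) (hB : νB (Iio 0) = 0)
    (s m r : ℕ) {u : ℝ} (hu : u < 0) : sumCdf νM νC νB s m r u = 0 := by
  have := isProbabilityMeasure_sumLaw (νM := νM) (νC := νC) (νB := νB) s m r
  have := isProbabilityMeasure_convPow νM (s + 1)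
  have := isProbabilityMeasure_convPow νC m
  have := isProbabilityMeasure_convPow νB r
  exact cdf_eq_zero_of_neg (conv_Iio_zero (convPow_Iio_zero hM _)
    (conv_Iio_zero (convPow_Iio_zero hC _) (convPow_Iio_zero hB _))) hu

/-- The renewal equation `νM = (1 - δ) δ₀ + δ (νB ∗ νM)` convolved with the other summands. -/
lemma sumCdf_succ_sup {δ : ℝ}
    (hren : ∀ v, cdf νM v = (1 - δ) * (Ici 0).indicator 1 v + δ * ∫ y, cdf νM (v - y) ∂νB)
    (s m r : ℕ) (u : ℝ) :
    sumCdf νM νC νB (s + 1) m r u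
      = (1 - δ) * sumCdf νM νC νB s m r u + δ * sumCdf νM νC νB (s + 1) m (r + 1) u := by
  have := isProbabilityMeasure_sumLaw (νM := νM) (νC := νC) (νB := νB) s m r
  have := isProbabilityMeasure_convPow νM (s + 1)
  have := isProbabilityMeasure_convPow νC m
  have := isProbabilityMeasure_convPow νB r
  have h1 : ∀ r, sumLaw νM νC νB (s + 1) m r = νM ∗ sumLaw νM νC νB s m r := by
    intro r
    have := isProbabilityMeasure_convPow νB r
    unfold sumLaw
    rw [convPow_succ νM, Measure.conv_assoc]
  have h2 : sumLaw νM νC νB s m (r + 1) = sumLaw νM νC νB s m r ∗ νB := by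
    unfold sumLaw
    rw [convPow_succ νB, Measure.conv_comm νB, ← Measure.conv_assoc (convPow νC m),
      ← Measure.conv_assoc (convPow νM _)]
  simp only [sumCdf]
  rw [h1, h1, h2, Measure.conv_comm νM, Measure.conv_comm νM, Measure.conv_assoc, cdf_conv,
    cdf_conv]
  simp_rw [cdf_conv νB νM]
  have h3 : ∫ y, (Ici (0 : ℝ)).indicator 1 (u - y) ∂(sumLaw νM νC νB s m r)
      = cdf (sumLaw νM νC νB s m r) u := by
    rw [cdf_eq_real, ← integral_indicator_one measurableSet_Iic]
    refine integral_congr_ae (ae_of_all _ fun y => ?_)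
    simp [indicator]
  rw [← h3, ← integral_const_mul, ← integral_const_mul, ← integral_add]
  · exact integral_congr_ae (ae_of_all _ fun y => hren (u - y))
  · refine Integrable.const_mul (integrable_of_measurable_of_abs_le (c := 1) ?_ fun x => ?_) _
    · exact (measurable_one.indicator measurableSet_Ici).comp (by fun_prop)
    · by_cases h : x ≤ u <;> simp [indicator, h]
  · simp_rw [← cdf_conv νB νM]
    exact (integrable_of_measurable_of_abs_le ((measurable_cdf _).comp (by fun_prop))
      (fun x => abs_cdf_le_one _ _)).const_mul _

lemma sumCdf_zero_sup {δ : ℝ}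
    (hren : ∀ v, cdf νM v = (1 - δ) * (Ici 0).indicator 1 v + δ * ∫ y, cdf νM (v - y) ∂νB)
    (u : ℝ) :
    sumCdf νM νC νB 0 0 0 u = (1 - δ) * (Ici 0).indicator 1 u + δ * sumCdf νM νC νB 0 0 1 u := by
  rw [sumCdf_succ_phase, sumCdf_zero]
  exact hren u

lemma integrable_exp_neg {ν : Measure ℝ} [IsProbabilityMeasure ν] (hν : ν (Iio 0) = 0) {τ : ℝ}
    (hτ : 0 ≤ τ) : Integrable (fun y => Real.exp (-(τ * y))) ν := by
  refine Integrable.of_bound (C := 1) (by fun_prop) ?_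
  filter_upwards [ae_nonneg_of_measure_Iio hν] with y hy
  rw [Real.norm_eq_abs, Real.abs_exp, Real.exp_le_one_iff]
  nlinarith

/-- Chernoff bound: the probability that the sum stays below `u` decays geometrically in the
number of excess variables, at the rate of their Laplace transform at `τ`. -/
lemma sumCdf_le (hM : νM (Iio 0) = 0) (hC : νC (Iio 0) = 0) (hB : νB (Iio 0) = 0) {τ q : ℝ}
    (hτ : 0 ≤ τ) (hqC : ∫ y, Real.exp (-(τ * y)) ∂νC ≤ q)
    (hqB : ∫ y, Real.exp (-(τ * y)) ∂νB ≤ q) (s m r : ℕ) (u : ℝ) :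
    sumCdf νM νC νB s m r u ≤ Real.exp (τ * u) * q ^ (m + r) := by
  have hq : 0 ≤ q := le_trans (integral_nonneg fun y => (Real.exp_pos _).le) hqC
  have key : ∀ (ν : Measure ℝ) [IsProbabilityMeasure ν], ν (Iio 0) = 0 →
      ∫ y, Real.exp (-(τ * y)) ∂ν ≤ q → ∀ (f : ℝ → ℝ) (c : ℝ), 0 ≤ c →
      (∀ v, 0 ≤ f v) → (∀ v, f v ≤ Real.exp (τ * v) * c) → ∀ u,
      ∫ y, f (u - y) ∂ν ≤ Real.exp (τ * u) * (c * q) := by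
    intro ν _ hν hqν f c hc hf0 hf u
    calc ∫ y, f (u - y) ∂ν ≤ ∫ y, Real.exp (τ * u) * c * Real.exp (-(τ * y)) ∂ν := by
          refine integral_mono_of_nonneg (ae_of_all _ fun y => hf0 _)
            ((integrable_exp_neg hν hτ).const_mul _) (ae_of_all _ fun y => ?_)
          refine (hf (u - y)).trans_eq ?_
          rw [mul_sub, sub_eq_add_neg, Real.exp_add]
          ring
      _ ≤ Real.exp (τ * u) * (c * q) := by
          rw [integral_const_mul, ← mul_assoc]
          exact mul_le_mul_of_nonneg_left hqν (by positivity)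
  have h0 : ∀ s m r v, 0 ≤ sumCdf νM νC νB s m r v := fun s m r v => cdf_nonneg _ _
  induction r generalizing u with
  | zero =>
    induction m generalizing u with
    | zero =>
      rcases lt_or_ge u 0 with hu | hu
      · rw [sumCdf_of_neg hM hC hB _ _ _ hu]
        positivity
      · refine (cdf_le_one _ _).trans ?_
        simpa using Real.one_le_exp (by positivity)
    | succ m ih =>
      rw [sumCdf_succ_heavy, add_right_comm, pow_succ]
      exact key νC hC hqC _ _ (by positivity) (h0 _ _ _) ih u
  | succ r ih =>
    rw [sumCdf_succ_phase, ← add_assoc, pow_succ]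
    exact key νB hB hqB _ _ (by positivity) (h0 _ _ _) ih u

end sumLaw

/-! ### Signed binomial sums of distribution functions -/

/-- The binomial sum `∑ₖ (n choose k) θᵏ (-δ)ⁿ⁻ᵏ F(s, k + a, n - k + b)`: when `F s m r` is the
distribution function of a sum of `s + 1`, `m` and `r` variables of the three kinds, this is the
distribution function of the signed measure
`νM^(s + 1) ∗ (θ νC - δ νB)ⁿ ∗ νCᵃ ∗ νBᵇ`, powers being convolution powers. -/
def mixedSum (δ θ : ℝ) (F : ℕ → ℕ → ℕ → ℝ → ℝ) (s n a b : ℕ) (u : ℝ) : ℝ :=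
  ∑ k ∈ Finset.range (n + 1), (n.choose k : ℝ) * θ ^ k * (-δ) ^ (n - k) * F s (k + a) (n - k + b) u

lemma mixedSum_zero (δ θ : ℝ) (F : ℕ → ℕ → ℕ → ℝ → ℝ) (s a b : ℕ) (u : ℝ) :
    mixedSum δ θ F s 0 a b u = F s a b u := by
  simp [mixedSum]

lemma mixedSum_succ (δ θ : ℝ) (F : ℕ → ℕ → ℕ → ℝ → ℝ) (s n a b : ℕ) (u : ℝ) :
    mixedSum δ θ F s (n + 1) a b u
      = θ * mixedSum δ θ F s n (a + 1) b u - δ * mixedSum δ θ F s n a (b + 1) u := by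
  have h : ∀ n a b, mixedSum δ θ F s n a b u = ∑ ij ∈ Finset.HasAntidiagonal.antidiagonal n,
      (n.choose ij.1 : ℝ) * (θ ^ ij.1 * (-δ) ^ ij.2 * F s (ij.1 + a) (ij.2 + b) u) := by
    intro n a b
    rw [Finset.Nat.sum_antidiagonal_eq_sum_range_succ (fun i j =>
      (n.choose i : ℝ) * (θ ^ i * (-δ) ^ j * F s (i + a) (j + b) u))]
    exact Finset.sum_congr rfl fun k _ => by ring
  rw [h, h, h, Finset.sum_antidiagonal_choose_succ_mul
    (fun i j => θ ^ i * (-δ) ^ j * F s (i + a) (j + b) u), Finset.mul_sum, Finset.mul_sum,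
    add_comm, sub_eq_add_neg, ← Finset.sum_neg_distrib]
  congr 1
  · refine Finset.sum_congr rfl fun ij hij => ?_
    rw [← Nat.choose_symm_of_eq_add (Finset.HasAntidiagonal.mem_antidiagonal.1 hij).symm, pow_succ,
      add_right_comm ij.1 1 a, add_assoc ij.1 a 1]
    ring
  · refine Finset.sum_congr rfl fun ij _ => ?_
    rw [pow_succ, add_right_comm ij.2 1 b, add_assoc ij.2 b 1]
    ring

lemma measurable_mixedSum {δ θ : ℝ} {F : ℕ → ℕ → ℕ → ℝ → ℝ} (hF : ∀ s m r, Measurable (F s m r))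
    (s n a b : ℕ) : Measurable (mixedSum δ θ F s n a b) :=
  Finset.measurable_sum _ fun _ _ => (hF _ _ _).const_mul _

lemma abs_mixedSum_le {δ θ : ℝ} (hδ : 0 ≤ δ) (hθ : 0 ≤ θ) {F : ℕ → ℕ → ℕ → ℝ → ℝ} {q c u : ℝ}
    (hF : ∀ s m r, |F s m r u| ≤ c * q ^ (m + r)) (s n a b : ℕ) :
    |mixedSum δ θ F s n a b u| ≤ c * (q ^ (a + b) * ((θ + δ) * q) ^ n) := by
  induction n generalizing a b with
  | zero =>
    rw [mixedSum_zero, pow_zero, mul_one]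
    exact hF s a b
  | succ n ih =>
    rw [mixedSum_succ]
    refine (abs_sub _ _).trans ?_
    rw [abs_mul, abs_mul, abs_of_nonneg hδ, abs_of_nonneg hθ]
    have h1 := mul_le_mul_of_nonneg_left (ih (a + 1) b) hθ
    have h2 := mul_le_mul_of_nonneg_left (ih a (b + 1)) hδ
    refine (add_le_add h1 h2).trans_eq ?_
    ring

lemma mixedSum_succ_sup {δ θ : ℝ} {F : ℕ → ℕ → ℕ → ℝ → ℝ} {u : ℝ}
    (hF : ∀ s m r, F (s + 1) m r u = (1 - δ) * F s m r u + δ * F (s + 1) m (r + 1) u)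
    (s n a b : ℕ) : mixedSum δ θ F (s + 1) n a b u
      = (1 - δ) * mixedSum δ θ F s n a b u + δ * mixedSum δ θ F (s + 1) n a (b + 1) u := by
  simp only [mixedSum]
  rw [Finset.mul_sum, Finset.mul_sum, ← Finset.sum_add_distrib]
  refine Finset.sum_congr rfl fun k _ => ?_
  rw [hF, ← add_assoc]
  ring

lemma integral_mixedSum {δ θ : ℝ} {F : ℕ → ℕ → ℕ → ℝ → ℝ} {ν : Measure ℝ} [IsProbabilityMeasure ν]
    (hm : ∀ s m r, Measurable (F s m r)) (h1 : ∀ s m r v, |F s m r v| ≤ 1) {i j : ℕ}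
    (hF : ∀ s m r u, F s (m + i) (r + j) u = ∫ y, F s m r (u - y) ∂ν) (s n a b : ℕ) (u : ℝ) :
    ∫ y, mixedSum δ θ F s n a b (u - y) ∂ν = mixedSum δ θ F s n (a + i) (b + j) u := by
  simp only [mixedSum]
  rw [integral_finsetSum]
  · refine Finset.sum_congr rfl fun k _ => ?_
    rw [integral_const_mul, ← hF, add_assoc, add_assoc]
  · intro k _
    exact (integrable_of_measurable_of_abs_le ((hm _ _ _).comp (by fun_prop))
      fun x => h1 _ _ _ _).const_mul _

/-! ### Series of functions and the renewal equation -/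

/-- Summation under the integral sign for series dominated by an exponential. -/
lemma hasSum_integral_comp_sub {f : ℕ → ℝ → ℝ} (hf : ∀ n, Measurable (f n)) {τ : ℝ} (hτ : 0 ≤ τ)
    (hb : ∀ n v, |f n v| ≤ Real.exp (τ * v) * (1 / 2) ^ n) {ν : Measure ℝ}
    [IsProbabilityMeasure ν] (hν : ν (Iio 0) = 0) (u : ℝ) :
    HasSum (fun n => ∫ y, f n (u - y) ∂ν) (∫ y, ∑' n, f n (u - y) ∂ν)
      ∧ Integrable (fun y => ∑' n, f n (u - y)) ν := by
  have hb' : ∀ n, ∀ᵐ y ∂ν, ‖f n (u - y)‖ ≤ Real.exp (τ * u) * (1 / 2) ^ n := by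
    intro n
    filter_upwards [ae_nonneg_of_measure_Iio hν] with y hy
    refine (hb n (u - y)).trans ?_
    gcongr
    linarith
  have hm : ∀ n, Measurable fun y => f n (u - y) := fun n => (hf n).comp (by fun_prop)
  have hgeo : Summable fun n : ℕ => Real.exp (τ * u) * (1 / 2) ^ n :=
    summable_geometric_two.mul_left _
  constructor
  · refine hasSum_integral_of_summable_integral_norm
      (fun n => Integrable.of_bound (hm n).aestronglyMeasurable _ (hb' n)) ?_
    refine Summable.of_nonneg_of_le (fun n => integral_nonneg fun y => norm_nonneg _)
      (fun n => ?_) hgeo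
    have := integral_mono_of_nonneg (ae_of_all ν fun y => norm_nonneg (f n (u - y)))
      (integrable_const _) (hb' n)
    simpa using this
  · have hmS : AEStronglyMeasurable (fun y => ∑' n, f n (u - y)) ν := by
      refine aestronglyMeasurable_of_tendsto_ae atTop
        (f := fun N y => ∑ n ∈ Finset.range N, f n (u - y))
        (fun N => (Finset.measurable_sum _ fun n _ => hm n).aestronglyMeasurable) ?_
      filter_upwards [ae_all_iff.2 hb'] with y hy
      exact (Summable.of_norm_bounded hgeo hy).hasSum.tendsto_sum_nat
    refine Integrable.of_bound hmS (∑' n : ℕ, Real.exp (τ * u) * (1 / 2) ^ n) ?_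
    filter_upwards [ae_all_iff.2 hb'] with y hy
    exact tsum_of_norm_bounded hgeo.hasSum hy

/-- Uniqueness of the locally bounded solution of a defective renewal equation. -/
lemma eq_zero_of_renewal {νB νC : Measure ℝ} [IsProbabilityMeasure νB] [IsProbabilityMeasure νC]
    (hB : νB (Iio 0) = 0) (hC : νC (Iio 0) = 0) {b c : ℝ} (hb : 0 ≤ b) (hc : 0 ≤ c)
    (hbc : b + c < 1) {D : ℝ → ℝ} {u K : ℝ} (hK : ∀ v, v ≤ u → |D v| ≤ K)
    (hD : ∀ v, D v = b * ∫ y, D (v - y) ∂νB + c * ∫ y, D (v - y) ∂νC) : D u = 0 := by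
  have key : ∀ n : ℕ, ∀ v, v ≤ u → |D v| ≤ K * (b + c) ^ n := by
    intro n
    induction n with
    | zero => simpa using hK
    | succ n ih =>
      intro v hv
      have h : ∀ (ν : Measure ℝ) [IsProbabilityMeasure ν], ν (Iio 0) = 0 →
          |∫ y, D (v - y) ∂ν| ≤ K * (b + c) ^ n := by
        intro ν _ hν
        have := norm_integral_le_of_norm_le_const (μ := ν) (f := fun y => D (v - y))
          (C := K * (b + c) ^ n) (by
            filter_upwards [ae_nonneg_of_measure_Iio hν] with y hy using ih _ (by linarith))
        simpa using this
      rw [hD v]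
      refine (abs_add_le _ _).trans ?_
      rw [abs_mul, abs_mul, abs_of_nonneg hb, abs_of_nonneg hc]
      have h1 := mul_le_mul_of_nonneg_left (h νB hB) hb
      have h2 := mul_le_mul_of_nonneg_left (h νC hC) hc
      refine (add_le_add h1 h2).trans_eq ?_
      ring
  have hlim : Tendsto (fun n : ℕ => K * (b + c) ^ n) atTop (𝓝 0) := by
    simpa using (tendsto_pow_atTop_nhds_zero_of_lt_one (add_nonneg hb hc) hbc).const_mul K
  exact abs_nonpos_iff.1 (ge_of_tendsto' hlim fun n => key n u le_rfl)

section expansion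

variable {νM νC νB : Measure ℝ} [IsProbabilityMeasure νM] [IsProbabilityMeasure νC]
  [IsProbabilityMeasure νB] {ε δ θ : ℝ}

/-- With `A n = mixedSum n n 0 0`, the distribution function of `νM^(n+1) ∗ (θ νC - δ νB)ⁿ`, this is
`(1 - δ νB) A (n + 1) = (1 - δ) (θ νC - δ νB) A n`. -/
lemma mixedSum_diag_succ
    (hren : ∀ v, cdf νM v = (1 - δ) * (Ici 0).indicator 1 v + δ * ∫ y, cdf νM (v - y) ∂νB)
    (n : ℕ) (u : ℝ) :
    mixedSum δ θ (sumCdf νM νC νB) (n + 1) (n + 1) 0 0 u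
        - δ * ∫ y, mixedSum δ θ (sumCdf νM νC νB) (n + 1) (n + 1) 0 0 (u - y) ∂νB
      = (1 - δ) * (θ * (∫ y, mixedSum δ θ (sumCdf νM νC νB) n n 0 0 (u - y) ∂νC)
        - δ * ∫ y, mixedSum δ θ (sumCdf νM νC νB) n n 0 0 (u - y) ∂νB) := by
  have hB := fun s n a b u => integral_mixedSum (δ := δ) (θ := θ) (ν := νB) (i := 0) (j := 1)
    (measurable_sumCdf νM νC νB) (abs_sumCdf_le_one νM νC νB)
    (fun s m r u => sumCdf_succ_phase s m r u) s n a b u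
  have hC := fun s n a b u => integral_mixedSum (δ := δ) (θ := θ) (ν := νC) (i := 1) (j := 0)
    (measurable_sumCdf νM νC νB) (abs_sumCdf_le_one νM νC νB)
    (fun s m r u => sumCdf_succ_heavy s m r u) s n a b u
  rw [hB, hB, hC, mixedSum_succ_sup (fun s m r => sumCdf_succ_sup hren s m r u),
    mixedSum_succ _ _ _ n]
  simp only [zero_add, add_zero]
  ring

lemma mixedSum_diag_zero
    (hren : ∀ v, cdf νM v = (1 - δ) * (Ici 0).indicator 1 v + δ * ∫ y, cdf νM (v - y) ∂νB)
    (u : ℝ) :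
    mixedSum δ θ (sumCdf νM νC νB) 0 0 0 0 u
        - δ * ∫ y, mixedSum δ θ (sumCdf νM νC νB) 0 0 0 0 (u - y) ∂νB
      = (1 - δ) * (Ici 0).indicator 1 u := by
  simp_rw [mixedSum_zero]
  rw [← sumCdf_succ_phase, sumCdf_zero_sup hren]
  ring

/-- The powers of the expansion parameter times the binomial sums decay geometrically, locally
uniformly, whatever the parameter. -/
lemma abs_pow_mul_mixedSum_le (hM : νM (Iio 0) = 0) (hC : νC (Iio 0) = 0) (hB : νB (Iio 0) = 0)
    (hδ : 0 ≤ δ) (hθ : 0 ≤ θ) {x q τ : ℝ} (hτ : 0 ≤ τ) (hq : |x| * ((θ + δ) * q) ≤ 1 / 2)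
    (hq1 : q ≤ 1) (hqC : ∫ y, Real.exp (-(τ * y)) ∂νC ≤ q)
    (hqB : ∫ y, Real.exp (-(τ * y)) ∂νB ≤ q) (s n a b : ℕ) (v : ℝ) :
    |x ^ n * mixedSum δ θ (sumCdf νM νC νB) s n a b v| ≤ Real.exp (τ * v) * (1 / 2) ^ n := by
  have hq0 : 0 ≤ q := le_trans (integral_nonneg fun y => (Real.exp_pos _).le) hqC
  have h := abs_mixedSum_le (u := v) hδ hθ (F := sumCdf νM νC νB) (q := q)
    (c := Real.exp (τ * v)) (fun s m r => by
      rw [abs_of_nonneg (show 0 ≤ sumCdf νM νC νB s m r v from cdf_nonneg _ _)]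
      exact sumCdf_le hM hC hB hτ hqC hqB s m r v) s n a b
  rw [abs_mul, abs_pow]
  calc |x| ^ n * |mixedSum δ θ (sumCdf νM νC νB) s n a b v|
      ≤ |x| ^ n * (Real.exp (τ * v) * (q ^ (a + b) * ((θ + δ) * q) ^ n)) := by gcongr
    _ = Real.exp (τ * v) * (q ^ (a + b) * (|x| * ((θ + δ) * q)) ^ n) := by
        rw [mul_pow |x|]
        ring
    _ ≤ Real.exp (τ * v) * (1 * (1 / 2) ^ n) := by
        gcongr
        exact pow_le_one₀ hq0 hq1
    _ = Real.exp (τ * v) * (1 / 2) ^ n := by rw [one_mul]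

/-- The expansion for distribution functions: a solution `H` of the renewal equation with kernel
`(1 - ε) δ νB + ε θ νC` is a multiple of the series of the binomial sums. -/
lemma hasSum_pow_mul_mixedSum (hM : νM (Iio 0) = 0) (hC : νC (Iio 0) = 0) (hB : νB (Iio 0) = 0)
    (hε0 : 0 ≤ ε) (hε1 : ε ≤ 1) (hδ0 : 0 ≤ δ) (hδ1 : δ < 1) (hθ : 0 ≤ θ)
    (hρ : (1 - ε) * δ + ε * θ < 1)
    (hren : ∀ v, cdf νM v = (1 - δ) * (Ici 0).indicator 1 v + δ * ∫ y, cdf νM (v - y) ∂νB)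
    {q τ : ℝ} (hτ : 0 ≤ τ) (hq : |ε / (1 - δ)| * ((θ + δ) * q) ≤ 1 / 2)
    (hq1 : q ≤ 1) (hqC : ∫ y, Real.exp (-(τ * y)) ∂νC ≤ q)
    (hqB : ∫ y, Real.exp (-(τ * y)) ∂νB ≤ q)
    {H : ℝ → ℝ} (hHm : Measurable H) (hH1 : ∀ v, |H v| ≤ 1)
    (hH : ∀ v, H v = (1 - ((1 - ε) * δ + ε * θ)) * (Ici 0).indicator 1 v
      + ((1 - ε) * δ * ∫ y, H (v - y) ∂νB + ε * θ * ∫ y, H (v - y) ∂νC)) (u : ℝ) :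
    ∃ S, HasSum (fun n => (ε / (1 - δ)) ^ n * mixedSum δ θ (sumCdf νM νC νB) n n 0 0 u) S ∧
      H u = (1 - ε / (1 - δ) * (θ - δ)) * S := by
  have hδ' : 1 - δ ≠ 0 := by linarith
  set x := ε / (1 - δ) with hx
  have hxε : x * (1 - δ) = ε := div_mul_cancel₀ _ hδ'
  set f : ℕ → ℝ → ℝ := fun n v => x ^ n * mixedSum δ θ (sumCdf νM νC νB) n n 0 0 v with hf
  have hfm : ∀ n, Measurable (f n) := fun n =>
    (measurable_mixedSum (measurable_sumCdf νM νC νB) n n 0 0).const_mul _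
  have hfb : ∀ n v, |f n v| ≤ Real.exp (τ * v) * (1 / 2) ^ n := fun n v =>
    abs_pow_mul_mixedSum_le hM hC hB hδ0 hθ hτ hq hq1 hqC hqB n n 0 0 v
  have hgeo : ∀ v, HasSum (fun n : ℕ => Real.exp (τ * v) * (1 / 2) ^ n) (Real.exp (τ * v) * 2) :=
    fun v => hasSum_geometric_two.mul_left _
  have hsum : ∀ v, Summable fun n => f n v := fun v =>
    Summable.of_norm_bounded (hgeo v).summable fun n => hfb n v
  set S : ℝ → ℝ := fun v => ∑' n, f n v with hS
  have hSb : ∀ v, |S v| ≤ Real.exp (τ * v) * 2 := fun v =>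
    tsum_of_norm_bounded (f := fun n => f n v) (hgeo v) fun n => hfb n v
  have hTB := fun v => hasSum_integral_comp_sub hfm hτ hfb hB v
  have hTC := fun v => hasSum_integral_comp_sub hfm hτ hfb hC v
  -- Summing `(1 - δ νB) A (n + 1) = (1 - δ) (θ νC - δ νB) A n` over `n`.
  have hSeq : ∀ v, S v - δ * ∫ y, S (v - y) ∂νB = (1 - δ) * (Ici 0).indicator 1 v
      + ε * (θ * (∫ y, S (v - y) ∂νC) - δ * ∫ y, S (v - y) ∂νB) := by
    intro v
    have h1 := (hsum v).hasSum.sub ((hTB v).1.mul_left δ)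
    have h2 := (((hTC v).1.mul_left θ).sub ((hTB v).1.mul_left δ)).mul_left ε
    have h3 := (hasSum_nat_add_iff' 1).2 h1
    have h4 : (fun n => f (n + 1) v - δ * ∫ y, f (n + 1) (v - y) ∂νB)
        = fun n => ε * (θ * (∫ y, f n (v - y) ∂νC) - δ * ∫ y, f n (v - y) ∂νB) := by
      funext n
      simp only [hf]
      rw [integral_const_mul, integral_const_mul, integral_const_mul]
      have := mixedSum_diag_succ (θ := θ) (νC := νC) hren n v
      linear_combination x ^ (n + 1) * this + x ^ n *
        (θ * (∫ y, mixedSum δ θ (sumCdf νM νC νB) n n 0 0 (v - y) ∂νC)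
        - δ * ∫ y, mixedSum δ θ (sumCdf νM νC νB) n n 0 0 (v - y) ∂νB) * hxε
    rw [h4] at h3
    have h5 := h3.unique h2
    have h6 := mixedSum_diag_zero (θ := θ) (νC := νC) hren v
    simp only [Finset.range_one, Finset.sum_singleton, hf, pow_zero, one_mul] at h5
    rw [h6] at h5
    simp only [hS, hf]
    linear_combination h5
  refine ⟨S u, (hsum u).hasSum, ?_⟩
  set c := 1 - x * (θ - δ) with hc
  have hcρ : c * (1 - δ) = 1 - ((1 - ε) * δ + ε * θ) := by
    rw [hc]
    linear_combination -(θ - δ) * hxε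
  have hzero := eq_zero_of_renewal hB hC (D := fun v => H v - c * S v) (u := u)
    (K := 1 + |c| * (Real.exp (τ * u) * 2)) (mul_nonneg (sub_nonneg.2 hε1) hδ0)
    (mul_nonneg hε0 hθ) hρ ?_ ?_
  · exact sub_eq_zero.1 hzero
  · intro v hv
    refine (abs_sub _ _).trans (add_le_add (hH1 v) ?_)
    rw [abs_mul]
    refine mul_le_mul_of_nonneg_left ((hSb v).trans ?_) (abs_nonneg _)
    gcongr
  · intro v
    have hHi : ∀ (ν : Measure ℝ) [IsProbabilityMeasure ν], Integrable (fun y => H (v - y)) ν :=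
      fun ν _ => integrable_of_measurable_of_abs_le (hHm.comp (by fun_prop)) fun y => hH1 _
    rw [integral_sub (hHi νB) ((hTB v).2.const_mul c), integral_sub (hHi νC)
      ((hTC v).2.const_mul c), integral_const_mul, integral_const_mul]
    linear_combination hH v - c * hSeq v - (Ici (0 : ℝ)).indicator 1 v * hcρ

/-- The two series of the expansion converge and sum up to the difference of the tails. -/
theorem exists_hasSum_terms (hM : νM (Iio 0) = 0) (hC : νC (Iio 0) = 0) (hB : νB (Iio 0) = 0)
    (hε0 : 0 ≤ ε) (hε1 : ε ≤ 1) (hδ0 : 0 ≤ δ) (hδ1 : δ < 1) (hθ : 0 ≤ θ)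
    (hρ : (1 - ε) * δ + ε * θ < 1)
    (hren : ∀ v, cdf νM v = (1 - δ) * (Ici 0).indicator 1 v + δ * ∫ y, cdf νM (v - y) ∂νB)
    (hlap : ∀ q : ℝ, 0 < q → ∃ τ : ℝ, 0 ≤ τ ∧ ∫ y, Real.exp (-(τ * y)) ∂νC ≤ q ∧
      ∫ y, Real.exp (-(τ * y)) ∂νB ≤ q)
    {H : ℝ → ℝ} (hHm : Measurable H) (hH1 : ∀ v, |H v| ≤ 1)
    (hH : ∀ v, H v = (1 - ((1 - ε) * δ + ε * θ)) * (Ici 0).indicator 1 v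
      + ((1 - ε) * δ * ∫ y, H (v - y) ∂νB + ε * θ * ∫ y, H (v - y) ∂νC)) (u : ℝ) :
    ∃ A B, HasSum (heavyTerm ε δ θ fun s m r => 1 - sumCdf νM νC νB s m r u) A ∧
      HasSum (phaseTerm ε δ θ fun s m r => 1 - sumCdf νM νC νB s m r u) B ∧
      1 - H u = (1 - cdf νM u) + θ * A - δ * B := by
  set x := ε / (1 - δ) with hx
  set F := sumCdf νM νC νB with hF
  have hd : 0 < 2 * (1 + |x| * (θ + δ)) := by positivity
  obtain ⟨τ, hτ, hqC, hqB⟩ := hlap (1 / (2 * (1 + |x| * (θ + δ)))) (by positivity)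
  set q := 1 / (2 * (1 + |x| * (θ + δ))) with hqdef
  have hq1 : q ≤ 1 := by
    rw [hqdef, div_le_one hd]
    have : 0 ≤ |x| * (θ + δ) := by positivity
    linarith
  have hq : |x| * ((θ + δ) * q) ≤ 1 / 2 := by
    rw [← mul_assoc, hqdef, mul_one_div, div_le_div_iff₀ hd (by norm_num)]
    linarith
  have hsum : ∀ (g : ℕ → ℕ) (a b : ℕ), Summable fun n =>
      x ^ (n + 1) * mixedSum δ θ F (g n) n a b u := by
    intro g a b
    have h : Summable fun n => x ^ n * mixedSum δ θ F (g n) n a b u :=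
      Summable.of_norm_bounded (summable_geometric_two.mul_left (Real.exp (τ * u))) fun n =>
        abs_pow_mul_mixedSum_le hM hC hB hδ0 hθ hτ hq hq1 hqC hqB (g n) n a b u
    refine (h.mul_left x).congr fun n => ?_
    ring
  have hheavy : (heavyTerm ε δ θ fun s m r => 1 - F s m r u) = fun n =>
      x ^ (n + 1) * mixedSum δ θ F n n 0 0 u - x ^ (n + 1) * mixedSum δ θ F (n + 1) n 1 0 u := by
    funext n
    rw [heavyTerm, ← mul_sub, mixedSum, mixedSum, ← Finset.sum_sub_distrib]
    congr 1
    refine Finset.sum_congr rfl fun k _ => ?_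
    simp only [add_zero]
    ring
  have hphase : (phaseTerm ε δ θ fun s m r => 1 - F s m r u) = fun n =>
      x ^ (n + 1) * mixedSum δ θ F n n 0 0 u - x ^ (n + 1) * mixedSum δ θ F (n + 1) n 0 1 u := by
    funext n
    rw [phaseTerm, ← mul_sub, mixedSum, mixedSum, ← Finset.sum_sub_distrib]
    congr 1
    refine Finset.sum_congr rfl fun k hk => ?_
    rw [Nat.sub_add_comm (Nat.lt_succ_iff.1 (Finset.mem_range.1 hk))]
    simp only [add_zero]
    ring
  have hA : Summable (heavyTerm ε δ θ fun s m r => 1 - F s m r u) := by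
    rw [hheavy]
    exact (hsum (fun n => n) 0 0).sub (hsum (fun n => n + 1) 1 0)
  have hB' : Summable (phaseTerm ε δ θ fun s m r => 1 - F s m r u) := by
    rw [hphase]
    exact (hsum (fun n => n) 0 0).sub (hsum (fun n => n + 1) 0 1)
  obtain ⟨S, hS, hHS⟩ := hasSum_pow_mul_mixedSum hM hC hB hε0 hε1 hδ0 hδ1 hθ hρ hren hτ hq hq1 hqC
    hqB hHm hH1 hH u
  refine ⟨_, _, hA.hasSum, hB'.hasSum, ?_⟩
  -- By Pascal's rule the combined series is `∑ xⁿ⁺¹ ((θ - δ) A n - A (n + 1))`.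
  have h1 := (hA.hasSum.mul_left θ).sub (hB'.hasSum.mul_left δ)
  have h2 := (hS.mul_left (x * (θ - δ))).sub ((hasSum_nat_add_iff' 1).2 hS)
  have h3 : (fun n => θ * heavyTerm ε δ θ (fun s m r => 1 - F s m r u) n
      - δ * phaseTerm ε δ θ (fun s m r => 1 - F s m r u) n)
      = fun n => x * (θ - δ) * (x ^ n * mixedSum δ θ F n n 0 0 u)
        - x ^ (n + 1) * mixedSum δ θ F (n + 1) (n + 1) 0 0 u := by
    funext n
    rw [hheavy, hphase, mixedSum_succ _ _ _ (n + 1) n]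
    ring
  rw [h3] at h1
  have h4 := h1.unique h2
  simp only [Finset.range_one, Finset.sum_singleton, pow_zero, one_mul, mixedSum_zero] at h4
  rw [hF, sumCdf_zero] at h4
  rw [hHS]
  linear_combination -h4

end expansion

/-! ### Mixtures of claim laws -/

lemma integral_id_pos_of_isHeavyTailed {μ : Measure ℝ} (hμ : IsHeavyTailed μ)
    (hint : Integrable (fun x : ℝ => x) μ) : 0 < ∫ x, x ∂μ := by
  obtain ⟨_, h0, hexp⟩ := hμ
  have hnn := ae_nonneg_of_measure_Iio h0
  refine lt_of_le_of_ne (integral_nonneg_of_ae hnn) fun h => ?_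
  have hz := (integral_eq_zero_iff_of_nonneg_ae hnn hint).1 h.symm
  have h1 : ∫⁻ x, ENNReal.ofReal (Real.exp (1 * x)) ∂μ = 1 := by
    rw [lintegral_congr_ae (g := fun _ => 1)]
    · simp
    · filter_upwards [hz] with x hx
      simp [hx]
  rw [hexp 1 one_pos] at h1
  exact ENNReal.top_ne_one h1

lemma claimLaw_Iio_zero {μB μC : Measure ℝ} {ε : ℝ} (hB : μB (Iio 0) = 0)
    (hC : μC (Iio 0) = 0) :
    claimLaw ε μB μC (Iio 0) = 0 := by
  simp [claimLaw, hB, hC]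

lemma integrable_claimLaw {μB μC : Measure ℝ} {ε : ℝ} {f : ℝ → ℝ} (hB : Integrable f μB)
    (hC : Integrable f μC) : Integrable f (claimLaw ε μB μC) :=
  (hB.smul_measure ENNReal.ofReal_ne_top).add_measure (hC.smul_measure ENNReal.ofReal_ne_top)

lemma integral_claimLaw {μB μC : Measure ℝ} {ε : ℝ} (h0 : 0 ≤ ε) (h1 : ε ≤ 1)
    {f : ℝ → ℝ} (hB : Integrable f μB) (hC : Integrable f μC) :
    ∫ x, f x ∂(claimLaw ε μB μC) = (1 - ε) * ∫ x, f x ∂μB + ε * ∫ x, f x ∂μC := by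
  rw [claimLaw, integral_add_measure (hB.smul_measure ENNReal.ofReal_ne_top)
    (hC.smul_measure ENNReal.ofReal_ne_top), integral_smul_measure, integral_smul_measure,
    ENNReal.toReal_ofReal (by linarith), ENNReal.toReal_ofReal h0, smul_eq_mul, smul_eq_mul]

section claimLaw

variable {μB μC : Measure ℝ} [IsProbabilityMeasure μB] [IsProbabilityMeasure μC] {ε : ℝ}

lemma isProbabilityMeasure_claimLaw (h0 : 0 ≤ ε) (h1 : ε ≤ 1) :
    IsProbabilityMeasure (claimLaw ε μB μC) := by
  constructor
  simp only [claimLaw, Measure.coe_add, Measure.coe_smul, Pi.add_apply, Pi.smul_apply,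
    measure_univ, smul_eq_mul, mul_one]
  rw [← ENNReal.ofReal_add (by linarith) h0]
  simp

lemma claimLaw_real (h0 : 0 ≤ ε) (h1 : ε ≤ 1) (s : Set ℝ) :
    (claimLaw ε μB μC).real s = (1 - ε) * μB.real s + ε * μC.real s := by
  have h : ∀ (c : ℝ) (μ : Measure ℝ) [IsProbabilityMeasure μ], (ENNReal.ofReal c • μ) s ≠ ⊤ := by
    intro c μ _
    rw [Measure.smul_apply, smul_eq_mul]
    exact ENNReal.mul_ne_top ENNReal.ofReal_ne_top (measure_ne_top _ _)
  rw [claimLaw, measureReal_add_apply (h _ _) (h _ _), measureReal_ennreal_smul_apply,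
    measureReal_ennreal_smul_apply, ENNReal.toReal_ofReal (by linarith), ENNReal.toReal_ofReal h0]

/-- The renewal equation for a mixture of claim laws, in terms of the excess laws of the
components. -/
lemma cdf_supLaw_claimLaw {Ω : Type*} [MeasurableSpace Ω] {P : Measure Ω} {lam : ℝ}
    {W U : ℕ → Ω → ℝ} (hlam : 0 < lam) (h0 : 0 ≤ ε) (h1 : ε ≤ 1)
    (hB0 : μB (Iio 0) = 0) (hC0 : μC (Iio 0) = 0)
    (hB : Integrable (fun x : ℝ => x) μB) (hC : Integrable (fun x : ℝ => x) μC)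
    (hBpos : 0 < ∫ x, x ∂μB) (hCpos : 0 < ∫ x, x ∂μC)
    (hload : load lam (claimLaw ε μB μC) < 1)
    (h : IsCramerLundberg P lam (claimLaw ε μB μC) W U) (v : ℝ) :
    cdf (supLaw P W U) v
      = (1 - ((1 - ε) * load lam μB + ε * load lam μC)) * (Ici 0).indicator 1 v
        + ((1 - ε) * load lam μB * ∫ y, cdf (supLaw P W U) (v - y) ∂(excess μB)
          + ε * load lam μC * ∫ y, cdf (supLaw P W U) (v - y) ∂(excess μC)) := by
  have := isProbabilityMeasure_claimLaw (μB := μB) (μC := μC) h0 h1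
  obtain ⟨_, hν0, hren⟩ := h.supLaw_spec hlam (claimLaw_Iio_zero hB0 hC0)
    (integrable_claimLaw hB hC) hload
  set ν := supLaw P W U
  rcases lt_or_ge v 0 with hv | hv
  · have hz : ∀ (F : Measure ℝ), ∫ y, cdf ν (v - y) ∂(excess F) = 0 := by
      intro F
      refine integral_eq_zero_of_ae ?_
      filter_upwards [ae_nonneg_of_measure_Iio (excess_Iio_zero F)] with y hy
      exact cdf_eq_zero_of_neg hν0 (by linarith)
    rw [hz, hz, cdf_eq_zero_of_neg hν0 hv]
    simp [hv]
  · have hint : ∀ (F : Measure ℝ) [IsProbabilityMeasure F], F (Iio 0) = 0 →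
        Integrable (fun x : ℝ => x) F →
        IntegrableOn (fun t => F.real (Ioi t) * cdf ν (v - t)) (Ioi 0) := by
      intro F _ hF0 hF
      refine ((integrableOn_measureReal_Ioi hF0 hF).bdd_mul (c := 1) (f := fun t => cdf ν (v - t))
        ((measurable_cdf ν).comp (by fun_prop)).aestronglyMeasurable
        (ae_of_all _ fun t => abs_cdf_le_one ν _)).congr (ae_of_all _ fun t => ?_)
      simp only [mul_comm]
    have hG : ∫ t in Ioi 0, (claimLaw ε μB μC).real (Ioi t) * cdf ν (v - t)
        = (1 - ε) * ((∫ x, x ∂μB) * ∫ y, cdf ν (v - y) ∂(excess μB))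
          + ε * ((∫ x, x ∂μC) * ∫ y, cdf ν (v - y) ∂(excess μC)) := by
      rw [integral_excess hBpos, integral_excess hCpos, ← integral_const_mul,
        ← integral_const_mul, ← integral_add ((hint μB hB0 hB).const_mul _)
        ((hint μC hC0 hC).const_mul _)]
      refine integral_congr_ae (ae_of_all _ fun t => ?_)
      dsimp only
      rw [claimLaw_real h0 h1]
      ring
    rw [hren v hv, hG, load, integral_claimLaw h0 h1 hB hC, load, load,
      indicator_of_mem (mem_Ici.2 hv)]
    simp only [Pi.one_apply]
    ring

end claimLaw

/-- Both Laplace transforms can be made small simultaneously. -/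
lemma exists_integral_exp_neg_excess_le {F G : Measure ℝ} [IsProbabilityMeasure F]
    [IsProbabilityMeasure G] (hF : 0 < ∫ x, x ∂F) (hG : 0 < ∫ x, x ∂G) {q : ℝ} (hq : 0 < q) :
    ∃ τ : ℝ, 0 ≤ τ ∧ ∫ y, Real.exp (-(τ * y)) ∂(excess F) ≤ q ∧
      ∫ y, Real.exp (-(τ * y)) ∂(excess G) ≤ q := by
  have h : ∀ (F : Measure ℝ) [IsProbabilityMeasure F], 0 < ∫ x, x ∂F → ∀ τ : ℝ, 0 < τ →
      1 / (∫ x, x ∂F) / q ≤ τ → ∫ y, Real.exp (-(τ * y)) ∂(excess F) ≤ q := by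
    intro F _ hF τ hτ h
    refine (integral_exp_neg_excess_le hF hτ).trans ?_
    rwa [div_le_iff₀ hτ, ← div_le_iff₀' hq]
  have hpos : 0 < 1 / (∫ x, x ∂F) / q := by positivity
  exact ⟨max (1 / (∫ x, x ∂F) / q) (1 / (∫ x, x ∂G) / q), hpos.le.trans (le_max_left _ _),
    h F hF _ (hpos.trans_le (le_max_left _ _)) (le_max_left _ _),
    h G hG _ (hpos.trans_le (le_max_left _ _)) (le_max_right _ _)⟩

/-- Stability of the perturbed model and smallness of `ε` force stability of the replace model. -/
lemma load_lt_one_of_lt_div {ε δ θ : ℝ} (hε : 0 ≤ ε) (hδ : 0 < δ) (hθ : 0 ≤ θ)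
    (hρ : (1 - ε) * δ + ε * θ < 1) (h : ε < |1 - δ| / max δ θ) : δ < 1 := by
  by_contra! hδ1
  rw [lt_div_iff₀ (lt_max_of_lt_left hδ), abs_of_nonpos (by linarith)] at h
  have h1 := mul_le_mul_of_nonneg_left (le_max_left δ θ) hε
  have h2 := mul_nonneg hε hθ
  linarith

end RuinReplace

open RuinReplace in
theorem theoremt
    {Ω Ω₀ : Type*} [MeasurableSpace Ω] [MeasurableSpace Ω₀]
    (P : Measure Ω) [IsProbabilityMeasure P] (P₀ : Measure Ω₀) [IsProbabilityMeasure P₀]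
    (μB μC : Measure ℝ)
    (hB : IsPhaseType μB) (hBint : Integrable (fun x : ℝ => x) μB) (hBpos : 0 < ∫ x, x ∂μB)
    (hC : IsHeavyTailed μC) (hCint : Integrable (fun x : ℝ => x) μC)
    (lam ε δ θ : ℝ) (hlam : 0 < lam) (hε : ε ∈ Set.Icc (0 : ℝ) 1)
    (hδ : δ = load lam μB) (hθ : θ = load lam μC)
    (hρ : load lam (claimLaw ε μB μC) < 1)
    (W U : ℕ → Ω → ℝ) (hWU : IsCramerLundberg P lam (claimLaw ε μB μC) W U)
    (W₀ U₀ : ℕ → Ω₀ → ℝ) (hWU₀ : IsCramerLundberg P₀ lam (claimLaw 0 μB μC) W₀ U₀)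
    (L : ℕ → ℕ → ℕ → ℝ → ℝ)
    (hL : L = tailL (supLaw P₀ W₀ U₀) (excess μC) (excess μB)) :
    (δ < 1 → ∀ u : ℝ, 0 ≤ u →
      L 0 0 0 u = ruinProb P₀ W₀ U₀ u ∧
      ∀ A B : ℝ,
        Tendsto (fun N => ∑ n ∈ Finset.range N, heavyTerm ε δ θ (fun s m r => L s m r u) n)
          atTop (𝓝 A) →
        Tendsto (fun N => ∑ n ∈ Finset.range N, phaseTerm ε δ θ (fun s m r => L s m r u) n)
          atTop (𝓝 B) →
        ruinProb P W U u = ruinProb P₀ W₀ U₀ u + θ * A - δ * B) ∧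
    (ε < |1 - δ| / max δ θ → ∀ u : ℝ, 0 ≤ u →
      ∃ A B : ℝ,
        HasSum (heavyTerm ε δ θ fun s m r => L s m r u) A ∧
        HasSum (phaseTerm ε δ θ fun s m r => L s m r u) B ∧
        ruinProb P W U u = ruinProb P₀ W₀ U₀ u + θ * A - δ * B) := by
  have hCpos := integral_id_pos_of_isHeavyTailed hC hCint
  obtain ⟨_, hB0, -⟩ := hB
  obtain ⟨_, hC0, -⟩ := hC
  obtain ⟨hε0, hε1⟩ := hε
  have hδ0 : 0 < δ := hδ ▸ mul_pos hlam hBpos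
  have hθ0 : 0 ≤ θ := hθ ▸ (mul_pos hlam hCpos).le
  have hloadε : load lam (claimLaw ε μB μC) = (1 - ε) * δ + ε * θ := by
    rw [hδ, hθ, load, integral_claimLaw hε0 hε1 hBint hCint, load, load]
    ring
  have hρ' : (1 - ε) * δ + ε * θ < 1 := hloadε ▸ hρ
  have hload0 : load lam (claimLaw 0 μB μC) = δ := by
    rw [hδ, load, integral_claimLaw le_rfl zero_le_one hBint hCint, load]
    ring
  have := isProbabilityMeasure_claimLaw (μB := μB) (μC := μC) hε0 hε1
  have := isProbabilityMeasure_claimLaw (μB := μB) (μC := μC) le_rfl zero_le_one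
  have := isProbabilityMeasure_excess hB0 hBint hBpos
  have := isProbabilityMeasure_excess hC0 hCint hCpos
  have hG0 := fun ε => claimLaw_Iio_zero (ε := ε) hB0 hC0
  have hGint := fun ε => integrable_claimLaw (ε := ε) hBint hCint
  -- The expansion holds, with convergent series, as soon as the replace model is stable.
  have main : δ < 1 → ∀ u, L 0 0 0 u = ruinProb P₀ W₀ U₀ u ∧ ∃ A B : ℝ,
      HasSum (heavyTerm ε δ θ fun s m r => L s m r u) A ∧
      HasSum (phaseTerm ε δ θ fun s m r => L s m r u) B ∧
      ruinProb P W U u = ruinProb P₀ W₀ U₀ u + θ * A - δ * B := by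
    intro hδ1 u
    have hρ₀ : load lam (claimLaw 0 μB μC) < 1 := hload0 ▸ hδ1
    obtain ⟨_, hν0, -⟩ := hWU.supLaw_spec hlam (hG0 ε) (hGint ε) hρ
    obtain ⟨_, hν₀0, -⟩ := hWU₀.supLaw_spec hlam (hG0 0) (hGint 0) hρ₀
    have hL' : ∀ s m r u,
        L s m r u = 1 - sumCdf (supLaw P₀ W₀ U₀) (excess μC) (excess μB) s m r u :=
      fun s m r u => hL ▸ tailL_eq s m r u
    have hruin : ∀ ν : Measure ℝ, IsProbabilityMeasure ν → ν.real (Ioi u) = 1 - cdf ν u := by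
      intro ν _
      rw [cdf_eq_real, ← compl_Iic, probReal_compl_eq_one_sub measurableSet_Iic]
    have hren : ∀ v, cdf (supLaw P₀ W₀ U₀) v = (1 - δ) * (Ici 0).indicator 1 v
        + δ * ∫ y, cdf (supLaw P₀ W₀ U₀) (v - y) ∂(excess μB) := by
      intro v
      have := cdf_supLaw_claimLaw hlam le_rfl zero_le_one hB0 hC0 hBint hCint hBpos hCpos hρ₀
        hWU₀ v
      rw [← hδ] at this
      linear_combination this
    have hH : ∀ v, cdf (supLaw P W U) v
        = (1 - ((1 - ε) * δ + ε * θ)) * (Ici 0).indicator 1 v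
          + ((1 - ε) * δ * ∫ y, cdf (supLaw P W U) (v - y) ∂(excess μB)
            + ε * θ * ∫ y, cdf (supLaw P W U) (v - y) ∂(excess μC)) := by
      intro v
      have := cdf_supLaw_claimLaw hlam hε0 hε1 hB0 hC0 hBint hCint hBpos hCpos hρ hWU v
      rwa [← hδ, ← hθ] at this
    rw [hWU.ruinProb_eq hlam (hG0 ε) (hGint ε) hρ, hWU₀.ruinProb_eq hlam (hG0 0) (hGint 0) hρ₀,
      hruin _ ‹_›, hruin _ ‹_›]
    simp only [hL']
    refine ⟨by rw [sumCdf_zero], ?_⟩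
    exact exists_hasSum_terms hν₀0 (excess_Iio_zero μC) (excess_Iio_zero μB) hε0 hε1 hδ0.le hδ1
      hθ0 hρ' hren (fun q hq => exists_integral_exp_neg_excess_le hCpos hBpos hq)
      (measurable_cdf _) (abs_cdf_le_one _) hH u
  refine ⟨fun hδ1 u _ => ⟨(main hδ1 u).1, fun A B hA hB => ?_⟩, fun hε u _ => ?_⟩
  · obtain ⟨A', B', hA', hB', h⟩ := (main hδ1 u).2
    rw [tendsto_nhds_unique hA hA'.tendsto_sum_nat, tendsto_nhds_unique hB hB'.tendsto_sum_nat]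
    exact h
  · exact (main (load_lt_one_of_lt_div hε0 hδ0 hθ0 hρ' hε) u).2
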